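/- **The model.** A network is a simple connected graph $G$ on $n$ nodes. The nodes carry pairwise distinct integer identifiers from $\{0,\dots,n^a-1\}$, for a fixed exponent $a$, and each node $v$ numbers its $\deg(v)$ communication ports arbitrarily. Initially a node knows only $n$, its own identifier, its degree, and the outcome of its own private random experiment; the experiments of distinct nodes are independent, with the same law. All nodes run the same program in synchronous rounds. In each round every node sends a (possibly different) message through each of its ports, receives the messages of its neighbours, and performs an unrestricted local computation. In the $\mathsf{CONGEST}$ model the messages have $O(\log n)$ bits. After the last round, every node outputs accept or reject. For $\ell\ge 3$, an algorithm *solves $C_\ell$-freeness with one-sided error probability $\varepsilon$* if, in every network, the following holds: if $G$ contains a cycle of length $\ell$ as a (not necessarily induced) subgraph, then with probability at least $1-\varepsilon$ at least one node rejects; otherwise all nodes accept with probability $1$. **Theorem.** For every integer $k\ge 2$ and every real $\varepsilon>0$, there is a randomized algorithm in the $\mathsf{CONGEST}$ model that solves $C_{2k}$-freeness with one-sided error probability $\varepsilon$ and whose number of rounds on $n$-node networks is $$O\Bigl(\max\{1,\log(1/\varepsilon)\}^2\cdot 2^{3k}\,k^{2k+3}\cdot n^{1-1/k}\Bigr).$$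 The constant in this bound is universal: it depends neither on $k$, nor on $\varepsilon$, nor on $n$, nor on $a$. The constant in the $O(\log n)$ bound on the message size depends only on $a$. -/

import Mathlib

/-- The decision of a node. -/
inductive Verdict where
  | accept
  | reject

/-- A network on `n` nodes: a simple connected graph, pairwise distinct identifiers from the
polynomial range `{0, …, n ^ a - 1}`, and at every node an arbitrary numbering `0, …, deg v - 1` of
the communication ports, which are in bijection with the neighbours of the node (so `deg v` is the
degree of `v`). -/
structure Network (n a : ℕ) where
  graph : SimpleGraph (Fin n)
  connected : graph.Connected
  ident : Fin n → ℕ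
  ident_injective : Function.Injective ident
  ident_lt : ∀ v, ident v < n ^ a
  deg : Fin n → ℕ
  port : (v : Fin n) → Fin (deg v) ≃ graph.neighborSet v

/-- The program run by every node of a network. A node draws a private random seed, and starts
from its own identifier, its number of ports, and its seed. In every round it sends a bit string
to each of its ports (the empty string stands for silence), receives the list of the strings that
arrive at ports `0, 1, …, deg v - 1`, and updates its state. After `rounds` rounds it outputs a
verdict. Local computation is not restricted. -/
structure NodeProgram where
  State : Type
  Seed : Type
  seed_finite : Finite Seed
  seedDist : PMF Seed
  init : (ident deg : ℕ) → Seed → State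
  send : State → (port : ℕ) → List Bool
  receive : State → (inbox : List (List Bool)) → State
  rounds : ℕ
  output : State → Verdict

/-- An algorithm for networks in which all nodes know the number `n` of nodes (and nothing else
about the network): for each `n`, the program run by all nodes of an `n`-node network. -/
abbrev DistributedAlgorithm : Type 1 := ℕ → NodeProgram

namespace NodeProgram

instance (P : NodeProgram) : Finite P.Seed := P.seed_finite

instance (P : NodeProgram) : MeasurableSpace P.Seed := ⊤

instance (P : NodeProgram) : DiscreteMeasurableSpace P.Seed := ⟨fun _ => trivial⟩

/-- No message is longer than `B` bits. -/
def BandwidthAtMost (P : NodeProgram) (B : ℕ) : Prop :=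
  ∀ (s : P.State) (p : ℕ), (P.send s p).length ≤ B

/-- `P.run N ω t v` is the state of node `v` after `t` synchronous rounds in the network `N`, when
each node `u` has drawn the seed `ω u`. At port `p`, node `v` receives what the neighbour `u`
behind that port sends to the port of `u` that leads to `v`. -/
def run (P : NodeProgram) {n a : ℕ} (N : Network n a) (ω : Fin n → P.Seed) :
    ℕ → Fin n → P.State
  | 0, v => P.init (N.ident v) (N.deg v) (ω v)
  | t + 1, v =>
    P.receive (run P N ω t v) (List.ofFn fun p : Fin (N.deg v) =>
      P.send (run P N ω t (N.port v p))
        ((N.port (N.port v p)).symm ⟨v, (N.port v p).2.symm⟩ : Fin _))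

/-- The verdict of node `v` at the end of the execution. -/
def verdict (P : NodeProgram) {n a : ℕ} (N : Network n a) (ω : Fin n → P.Seed) (v : Fin n) :
    Verdict :=
  P.output (P.run N ω P.rounds v)

/-- The joint law of the seeds of the `n` nodes: they are independent, each with law
`P.seedDist`. -/
noncomputable def seedMeasure (P : NodeProgram) (n : ℕ) :
    MeasureTheory.Measure (Fin n → P.Seed) :=
  MeasureTheory.Measure.pi fun _ => P.seedDist.toMeasure

end NodeProgram

namespace DistributedAlgorithm

/-- The messages of the algorithm have at most `b * ⌈log₂ n⌉` bits in `n`-node networks. -/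
def IsCongest (A : DistributedAlgorithm) (b : ℕ) : Prop :=
  ∀ n : ℕ, (A n).BandwidthAtMost (b * Nat.clog 2 n)

/-- The algorithm solves `C_ℓ`-freeness with one-sided error probability `ε`, on networks with
identifiers below `n ^ a`: if the graph contains a cycle of length `ℓ` as a (not necessarily
induced) subgraph then with probability at least `1 - ε` some node rejects, and otherwise all nodes
accept with probability `1`. -/
def SolvesCycleFreeness (A : DistributedAlgorithm) (a ℓ : ℕ) (ε : ℝ) : Prop :=
  ∀ (n : ℕ) (N : Network n a),
    ((SimpleGraph.cycleGraph ℓ).IsContained N.graph →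
      1 - ε ≤ ((A n).seedMeasure n).real {ω | ∃ v, (A n).verdict N ω v = Verdict.reject}) ∧
    (¬ (SimpleGraph.cycleGraph ℓ).IsContained N.graph →
      ((A n).seedMeasure n).real {ω | ∀ v, (A n).verdict N ω v = Verdict.accept} = 1)

end DistributedAlgorithm

/-! The algorithm is colour coding with threshold-limited flooding. Write `m = max 1 (log (1/ε))`.
Each node draws a colour in `{0, …, 2k-1}` uniformly, so a given `2k`-cycle is coloured
consecutively with probability at least `(2k)^(-2k)`, and about `3m (2k)^(2k)` independent
colourings miss it with probability at most `exp (-3m)`. In one colouring, sources of colour `0`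
flood their identifiers through the colours `1, …, k-1` and through `2k-1, …, k+1`. If a node of
colour `k` hears the same identifier from both sides, the two paths have distinct colours and close
up to a `2k`-cycle; this makes the error one-sided (`isContained_of_rejects`).

A node at level `i` forwards nothing if it holds more than `2^i k M` identifiers, with `M` of order
`k² m n^(1-1/k)`. What needs proof is that the floods finding some cycle are never cut off. Each
node is selected with probability of order `k² m / n^(1/k)`, or surely if this exceeds `1`. With
high probability the selected set `S` has at most `M` elements, and a prescribed node of degree
above `n^(1/k)` is selected or has `k²` selected neighbours (`exists_bad_selection`). Three kinds of
flood are run. If a `2k`-cycle meets `S`, floods from selected sources find it, and there are at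
most `M` sources. If all nodes of the cycle have degree at most `n^(1/k)`, floods among such nodes
find it, and at most `n^(i/k)` sources reach a node at level `i`. Otherwise no `2k`-cycle meets `S`,
and floods outside `S` start from the nodes with at least `k²` neighbours in `S`
(`exists_detectable_cycle`).

The last kind rests on a density argument (`card_layeredReach_le`): if too many sources reached a
node, the edges between these sources and `S` would contain a dense bipartite core, and a long
alternating path in it, joined to two paths through the layers, would be a `2k`-cycle meeting `S`.
Peeling off vertices of small degree, level by level, turns this into the bound `2^i (k-1)` on the
number of surviving edges at each element of `S` at level `i+1`. -/

/-! ### Fixed-width encoding of lists of natural numbers -/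

/-- The concatenation of the `w`-bit binary expansions of the entries of a list. -/
def encodeList (w : ℕ) (l : List ℕ) : List Bool :=
  l.flatMap fun x => List.ofFn fun i : Fin w => x.testBit i

theorem length_encodeList (w : ℕ) (l : List ℕ) : (encodeList w l).length = l.length * w := by
  induction l with
  | nil => simp [encodeList]
  | cons x l ih =>
    rw [encodeList, List.flatMap_cons, List.length_append, ← encodeList, ih]
    simp [Nat.succ_mul, Nat.add_comm]

/-- Positive width is needed so that the length of the code determines the length of the list; the
bits then determine the entries one at a time. -/
theorem encodeList_injOn {w : ℕ} (hw : 1 ≤ w) :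
    Set.InjOn (encodeList w) {l | ∀ x ∈ l, x < 2 ^ w} := by
  intro l hl l' hl' h
  induction l generalizing l' with
  | nil =>
    have := congrArg List.length h
    rw [length_encodeList, length_encodeList] at this
    have h0 : l'.length = 0 := by
      rcases Nat.mul_eq_zero.1 (this.symm.trans (by simp)) with h | h
      · exact h
      · omega
    exact (List.length_eq_zero_iff.1 h0).symm
  | cons x l ih =>
    cases l' with
    | nil =>
      have := congrArg List.length h
      rw [length_encodeList, length_encodeList] at this
      simp at this
      omega
    | cons y l' =>
      rw [encodeList, encodeList, List.flatMap_cons, List.flatMap_cons] at h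
      obtain ⟨h1, h2⟩ := List.append_inj h (by simp)
      have hxy : x = y := by
        apply Nat.eq_of_testBit_eq
        intro i
        by_cases hi : i < w
        · exact congrFun (List.ofFn_injective h1) ⟨i, hi⟩
        · have hpow : 2 ^ w ≤ 2 ^ i := Nat.pow_le_pow_right (by norm_num) (by omega)
          rw [Nat.testBit_lt_two_pow ((hl x (by simp)).trans_le hpow),
            Nat.testBit_lt_two_pow ((hl' y (by simp)).trans_le hpow)]
      rw [hxy, ih (fun z hz => hl z (by simp [hz])) (fun z hz => hl' z (by simp [hz])) h2]

/-- A left inverse of `encodeList w` on lists with entries below `2 ^ w`. -/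
noncomputable def decodeList (w : ℕ) : List Bool → List ℕ :=
  Function.invFunOn (encodeList w) {l | ∀ x ∈ l, x < 2 ^ w}

theorem decodeList_encodeList {w : ℕ} (hw : 1 ≤ w) {l : List ℕ} (hl : ∀ x ∈ l, x < 2 ^ w) :
    decodeList w (encodeList w l) = l :=
  (encodeList_injOn hw).leftInvOn_invFunOn hl

/-! ### Broadcast protocols -/

/-- What a node knows at the start: its identifier, its degree, and its seed. -/
structure LocalInput (σ : Type) where
  ident : ℕ
  deg : ℕ
  seed : σ

/-- A protocol in which, at each step, every node broadcasts a list of natural numbers, computed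
from its input and from the lists it has received at the previous steps (`hist s` is the
concatenation of the lists received at step `s`). -/
abbrev BroadcastProtocol (σ : Type) : Type :=
  LocalInput σ → (hist : ℕ → List ℕ) → (step : ℕ) → List ℕ

namespace BroadcastProtocol

variable {σ : Type} {n a : ℕ}

/-- The initial knowledge of a node of a network. -/
def input (N : Network n a) (ω : Fin n → σ) (v : Fin n) : LocalInput σ :=
  ⟨N.ident v, N.deg v, ω v⟩

/-- The lists received by `v` during the first `t` steps. -/
def hist (A : BroadcastProtocol σ) (N : Network n a) (ω : Fin n → σ) :
    ℕ → Fin n → ℕ → List ℕ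
  | 0, _ => fun _ => []
  | t + 1, v => Function.update (hist A N ω t v) t
      ((List.range (N.deg v)).flatMap fun p => if h : p < N.deg v then
        A (input N ω (N.port v ⟨p, h⟩)) (hist A N ω t (N.port v ⟨p, h⟩)) t else [])

/-- The message sent by `v` at step `t`. -/
def sent (A : BroadcastProtocol σ) (N : Network n a) (ω : Fin n → σ) (t : ℕ) (v : Fin n) : List ℕ :=
  A (input N ω v) (hist A N ω t v) t

/-- The concatenation of the messages received by `v` at step `t`. -/
def received (A : BroadcastProtocol σ) (N : Network n a) (ω : Fin n → σ) (t : ℕ) (v : Fin n) :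
    List ℕ :=
  (List.range (N.deg v)).flatMap fun p => if h : p < N.deg v then
    A.sent N ω t (N.port v ⟨p, h⟩) else []

theorem hist_eq (A : BroadcastProtocol σ) (N : Network n a) (ω : Fin n → σ) (t : ℕ) (v : Fin n)
    (s : ℕ) : A.hist N ω t v s = if s < t then A.received N ω s v else [] := by
  induction t with
  | zero => simp [hist]
  | succ t ih =>
    rw [hist]
    by_cases h : s = t
    · subst h
      simp [received, sent]
    · rw [Function.update_of_ne h, ih]
      have : s < t + 1 ↔ s < t := by omega
      simp only [this]

theorem hist_of_lt (A : BroadcastProtocol σ) (N : Network n a) (ω : Fin n → σ) {t s : ℕ}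
    (h : s < t) (v : Fin n) : A.hist N ω t v s = A.received N ω s v := by
  rw [hist_eq, if_pos h]

theorem mem_received {A : BroadcastProtocol σ} {N : Network n a} {ω : Fin n → σ} {t : ℕ}
    {v : Fin n} {x : ℕ} :
    x ∈ A.received N ω t v ↔ ∃ u, N.graph.Adj v u ∧ x ∈ A.sent N ω t u := by
  simp only [received, List.mem_flatMap, List.mem_range]
  constructor
  · rintro ⟨p, hp, hx⟩
    rw [dif_pos hp] at hx
    exact ⟨_, (N.port v ⟨p, hp⟩).2, hx⟩
  · rintro ⟨u, hu, hx⟩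
    refine ⟨(N.port v).symm ⟨u, hu⟩, Fin.is_lt _, ?_⟩
    simpa using hx

/-- Since multiplicities are kept, a node can count its selected neighbours from the length of what
it receives. -/
theorem length_received (A : BroadcastProtocol σ) (N : Network n a) (ω : Fin n → σ) (t : ℕ)
    (v : Fin n) [DecidableRel N.graph.Adj] :
    (A.received N ω t v).length = ∑ u ∈ N.graph.neighborFinset v, (A.sent N ω t u).length := by
  rw [received, List.length_flatMap, ← Fin.sum_univ_getElem]
  have h1 : ∑ i : Fin (N.deg v), (A.sent N ω t (N.port v i)).length =
      ∑ u ∈ N.graph.neighborFinset v, (A.sent N ω t u).length := by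
    rw [Equiv.sum_comp (N.port v) (fun u : N.graph.neighborSet v => (A.sent N ω t u).length)]
    rw [← Finset.sum_coe_sort (N.graph.neighborFinset v)]
    exact Fintype.sum_equiv (Equiv.subtypeEquivRight (by simp)) _ _ (fun _ => rfl)
  rw [← h1]
  refine Fintype.sum_equiv (finCongr (by simp)) _ _ ?_
  intro i
  have hi : (i : ℕ) < N.deg v := by simpa using i.2
  simp [hi]
  rfl

theorem card_neighborFinset (N : Network n a) (v : Fin n) [DecidableRel N.graph.Adj] :
    (N.graph.neighborFinset v).card = N.deg v := by
  rw [SimpleGraph.card_neighborFinset_eq_degree, ← SimpleGraph.card_neighborSet_eq_degree,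
    ← Fintype.card_congr (N.port v), Fintype.card_fin]

/-! ### Simulation of a broadcast protocol by short messages -/

/-- The state of a node simulating a broadcast protocol: `step` is the current step, `chunk` the
number of rounds already spent on it, and `buffer p` the bits received at port `p` so far. -/
structure SimulationState (σ : Type) where
  input : LocalInput σ
  hist : ℕ → List ℕ
  step : ℕ
  chunk : ℕ
  buffer : ℕ → List Bool

/-- Append the incoming bits to the buffers. -/
def SimulationState.store (s : SimulationState σ) (inbox : List (List Bool)) : SimulationState σ :=
  { s with chunk := s.chunk + 1, buffer := fun p => s.buffer p ++ inbox.getD p [] }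

/-- Append the incoming bits to the buffers, decode them, and proceed to the next step. -/
noncomputable def SimulationState.advance (w : ℕ) (s : SimulationState σ)
    (inbox : List (List Bool)) : SimulationState σ where
  input := s.input
  hist := Function.update s.hist s.step ((List.range s.input.deg).flatMap fun p =>
    decodeList w (s.buffer p ++ inbox.getD p []))
  step := s.step + 1
  chunk := 0
  buffer := fun _ => []

open Classical in
/-- The program simulating the first `T` steps of a broadcast protocol by messages of `w` bits,
spending `L t` rounds on step `t`. -/
noncomputable def compile (A : BroadcastProtocol σ) [Finite σ] (dist : PMF σ) (w : ℕ) (L : ℕ → ℕ)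
    (T : ℕ) (rejects : LocalInput σ → (ℕ → List ℕ) → Prop) : NodeProgram where
  State := SimulationState σ
  Seed := σ
  seed_finite := inferInstance
  seedDist := dist
  init i d x := ⟨⟨i, d, x⟩, fun _ => [], 0, 0, fun _ => []⟩
  send s _ := ((encodeList w (A s.input s.hist s.step)).drop (s.chunk * w)).take w
  receive s inbox := if s.chunk + 1 < L s.step then s.store inbox else s.advance w inbox
  rounds := ∑ t ∈ Finset.range T, L t
  output s := if rejects s.input s.hist then .reject else .accept

variable {A : BroadcastProtocol σ} {dist : PMF σ} {w : ℕ} {L : ℕ → ℕ}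
  {T : ℕ} {rejects : LocalInput σ → (ℕ → List ℕ) → Prop} {N : Network n a} {ω : Fin n → σ}

/-- The state of the simulation after `j` rounds of step `t`. -/
def simulationState (A : BroadcastProtocol σ) (w : ℕ) (N : Network n a) (ω : Fin n → σ)
    (t j : ℕ) (v : Fin n) : SimulationState σ :=
  ⟨input N ω v, A.hist N ω t v, t, j, fun p => if h : p < N.deg v then
    (encodeList w (A.sent N ω t (N.port v ⟨p, h⟩))).take (j * w) else []⟩

/-- The message of round `j` consists of the bits in positions `j * w` to `(j + 1) * w - 1`, so it
extends the received prefix by one chunk. -/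
theorem receive_simulationState {t j : ℕ} {v : Fin n} {inbox : List (List Bool)}
    (hinbox : inbox = List.ofFn fun p : Fin (N.deg v) =>
      ((encodeList w (A.sent N ω t (N.port v p))).drop (j * w)).take w) (p : ℕ) :
    (A.simulationState w N ω t j v).buffer p ++ inbox.getD p [] =
      (A.simulationState w N ω t (j + 1) v).buffer p := by
  subst hinbox
  by_cases hp : p < N.deg v
  · simp only [simulationState, dif_pos hp]
    rw [Nat.succ_mul, List.take_add]
    simp [List.getD, hp]
  · simp [simulationState, hp, List.getD]

variable [Finite σ]

theorem compile_bandwidthAtMost : (A.compile dist w L T rejects).BandwidthAtMost w :=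
  fun _ _ => List.length_take_le _ _

/-- A list of at most `L t` entries has a code of at most `L t * w` bits, so the last chunk of the
step completes it and decoding is correct. -/
theorem run_compile_add (hw : 1 ≤ w) {t j r : ℕ} (hj : j < L t)
    (hlen : ∀ v, (A.sent N ω t v).length ≤ L t) (hlt : ∀ v, ∀ x ∈ A.sent N ω t v, x < 2 ^ w)
    (hr : ∀ v, (A.compile dist w L T rejects).run N ω r v = A.simulationState w N ω t j v)
    (v : Fin n) :
    (A.compile dist w L T rejects).run N ω (r + 1) v =
      if j + 1 < L t then A.simulationState w N ω t (j + 1) v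
      else A.simulationState w N ω (t + 1) 0 v := by
  have hrun : (A.compile dist w L T rejects).run N ω (r + 1) v =
      (A.compile dist w L T rejects).receive ((A.compile dist w L T rejects).run N ω r v)
        (List.ofFn fun p : Fin (N.deg v) => (A.compile dist w L T rejects).send
          ((A.compile dist w L T rejects).run N ω r (N.port v p))
          ((N.port (N.port v p)).symm ⟨v, (N.port v p).2.symm⟩ : Fin _)) := rfl
  rw [hrun]
  simp only [hr]
  have hbuf := receive_simulationState (A := A) (w := w) (N := N) (ω := ω) (t := t) (j := j)
    (v := v) rfl
  by_cases hj1 : j + 1 < L t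
  · rw [if_pos hj1]
    refine (if_pos (c := j + 1 < L t) hj1).trans ?_
    exact (SimulationState.mk.injEq ..).mpr ⟨rfl, rfl, rfl, rfl, funext hbuf⟩
  · have hjL : j + 1 = L t := by omega
    rw [if_neg hj1]
    refine (if_neg (c := j + 1 < L t) hj1).trans ?_
    refine (SimulationState.mk.injEq ..).mpr ⟨rfl, ?_, rfl, rfl, funext fun p => by simp⟩
    rw [hist]
    change Function.update (A.hist N ω t v) t _ = _
    congr 1
    change List.flatMap _ (List.range (N.deg v)) = _
    refine List.flatMap_congr fun p hp => ?_
    rw [List.mem_range] at hp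
    refine (congrArg (decodeList w) (hbuf p)).trans ?_
    simp only [simulationState, dif_pos hp]
    rw [List.take_of_length_le, decodeList_encodeList hw (hlt _)]
    · rfl
    · rw [length_encodeList, hjL]
      exact Nat.mul_le_mul_right _ (hlen _)

/-- After the rounds of the first `t` steps, every node knows what it has received during these
steps of the broadcast protocol. -/
theorem run_compile (hw : 1 ≤ w) (hL : ∀ t, 1 ≤ L t)
    (hlen : ∀ t v, (A.sent N ω t v).length ≤ L t) (hlt : ∀ t v, ∀ x ∈ A.sent N ω t v, x < 2 ^ w)
    (t : ℕ) (v : Fin n) :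
    (A.compile dist w L T rejects).run N ω (∑ s ∈ Finset.range t, L s) v =
      A.simulationState w N ω t 0 v := by
  induction t generalizing v with
  | zero =>
    refine (SimulationState.mk.injEq ..).mpr ⟨rfl, rfl, rfl, rfl, funext fun p => by simp⟩
  | succ t ih =>
    have key : ∀ j < L t, ∀ v,
        (A.compile dist w L T rejects).run N ω ((∑ s ∈ Finset.range t, L s) + j) v =
          A.simulationState w N ω t j v := by
      intro j
      induction j with
      | zero => exact fun _ => ih
      | succ j ihj =>
        intro hj v
        rw [← Nat.add_assoc, run_compile_add hw (by omega) (hlen t) (hlt t) (ihj (by omega)),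
          if_pos hj]
    have hpos := hL t
    have := run_compile_add (r := (∑ s ∈ Finset.range t, L s) + (L t - 1)) hw
      (Nat.sub_lt hpos one_pos) (hlen t) (hlt t) (key _ (Nat.sub_lt hpos one_pos)) v
    rw [if_neg (by omega)] at this
    rw [Finset.sum_range_succ, ← this]
    congr 1
    omega

theorem verdict_compile_eq_reject_iff (hw : 1 ≤ w) (hL : ∀ t, 1 ≤ L t)
    (hlen : ∀ t v, (A.sent N ω t v).length ≤ L t) (hlt : ∀ t v, ∀ x ∈ A.sent N ω t v, x < 2 ^ w)
    (v : Fin n) :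
    (A.compile dist w L T rejects).verdict N ω v = .reject ↔
      rejects (input N ω v) (A.hist N ω T v) := by
  have : (A.compile dist w L T rejects).verdict N ω v =
      (A.compile dist w L T rejects).output (A.simulationState w N ω T 0 v) :=
    congrArg _ (run_compile hw hL hlen hlt T v)
  rw [this]
  simp only [compile, simulationState]
  split_ifs with h <;> simp [h]

end BroadcastProtocol

section CycleCombinatorics

open scoped Classical

/-! ### Cycles as periodic sequences of vertices -/

/-- `f` runs around a cycle of length `ℓ`. -/
structure IsCycleSeq {V : Type*} (G : SimpleGraph V) (ℓ : ℕ) (f : ℕ → V) : Prop where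
  periodic : Function.Periodic f ℓ
  inj : ∀ m < ℓ, ∀ m' < ℓ, f m = f m' → m = m'
  adj : ∀ m, G.Adj (f m) (f (m + 1))

namespace IsCycleSeq

variable {V : Type*} {G : SimpleGraph V} {ℓ : ℕ}

theorem shift {f : ℕ → V} (hf : IsCycleSeq G ℓ f) (c : ℕ) :
    IsCycleSeq G ℓ (fun m => f (m + c)) where
  periodic m := by
    have := hf.periodic (m + c)
    rwa [show m + c + ℓ = m + ℓ + c by omega] at this
  inj m hm m' hm' h := by
    have hℓ : 0 < ℓ := by omega
    rw [← hf.periodic.map_mod_nat (m + c), ← hf.periodic.map_mod_nat (m' + c)] at h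
    have := hf.inj _ (Nat.mod_lt _ hℓ) _ (Nat.mod_lt _ hℓ) h
    have h2 : m ≡ m' [MOD ℓ] := Nat.ModEq.add_right_cancel' c this
    rwa [Nat.ModEq, Nat.mod_eq_of_lt hm, Nat.mod_eq_of_lt hm'] at h2
  adj m := by
    have := hf.adj (m + c)
    rwa [show m + c + 1 = m + 1 + c by omega] at this

theorem of_lt {g : ℕ → V} (hℓ : 0 < ℓ) (hinj : ∀ m < ℓ, ∀ m' < ℓ, g m = g m' → m = m')
    (hadj : ∀ m, m + 1 < ℓ → G.Adj (g m) (g (m + 1))) (hlast : G.Adj (g (ℓ - 1)) (g 0)) :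
    IsCycleSeq G ℓ (fun m => g (m % ℓ)) where
  periodic m := by simp
  inj m hm m' hm' h := by
    simp only [Nat.mod_eq_of_lt hm, Nat.mod_eq_of_lt hm'] at h
    exact hinj m hm m' hm' h
  adj m := by
    have hlt := Nat.mod_lt m hℓ
    by_cases h : m % ℓ + 1 < ℓ
    · have : (m + 1) % ℓ = m % ℓ + 1 := by
        rw [← Nat.mod_add_mod, Nat.mod_eq_of_lt h]
      simp only [this]
      exact hadj _ h
    · have h1 : m % ℓ = ℓ - 1 := by omega
      have : (m + 1) % ℓ = 0 := by
        rw [← Nat.mod_add_mod, h1, Nat.sub_add_cancel hℓ, Nat.mod_self]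
      simp only [this, h1]
      exact hlast

/-- Lets a cycle be assembled by concatenating paths. -/
theorem exists_of_list {l : List V} (hl : l ≠ []) (hnd : l.Nodup) (hch : l.IsChain G.Adj)
    (hlast : G.Adj (l.getLast hl) (l.head hl)) :
    ∃ f, IsCycleSeq G l.length f ∧ ∀ x ∈ l, ∃ m, f m = x := by
  have hpos : 0 < l.length := List.length_pos_iff.2 hl
  have hget : ∀ m (hm : m < l.length), l.getD m (l.head hl) = l[m] := fun m hm => by
    simp [List.getD, hm]
  refine ⟨fun m => l.getD (m % l.length) (l.head hl), of_lt (g := fun m => l.getD m (l.head hl))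
    hpos ?_ ?_ ?_, ?_⟩
  · intro m hm m' hm' h
    simp only [hget _ hm, hget _ hm'] at h
    exact (hnd.getElem_inj_iff).1 h
  · intro m hm
    simp only [hget _ hm, hget m (by omega)]
    exact (List.isChain_iff_getElem.1 hch) m hm
  · simp only [hget _ (Nat.sub_lt hpos one_pos), hget _ hpos]
    rwa [List.getLast_eq_getElem, List.head_eq_getElem] at hlast
  · intro x hx
    obtain ⟨m, hm, rfl⟩ := List.getElem_of_mem hx
    exact ⟨m, by simp only [Nat.mod_eq_of_lt hm, hget _ hm]⟩

theorem isContained {f : ℕ → V} (hf : IsCycleSeq G (ℓ + 1) f) :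
    (SimpleGraph.cycleGraph (ℓ + 1)).IsContained G := by
  have key : ∀ u v : Fin (ℓ + 1), u - v = 1 → G.Adj (f v) (f u) := by
    intro u v h
    have hu : u = v + 1 := by rw [← h]; abel
    have := hf.adj v
    rw [← hf.periodic.map_mod_nat (v + 1)] at this
    rw [hu, Fin.val_add]
    rcases ℓ with _ | ℓ
    · simp at this
    · simpa using this
  refine ⟨⟨⟨fun i => f i, ?_⟩, ?_⟩⟩
  · intro u v huv
    rw [SimpleGraph.cycleGraph_eq_circulantGraph] at huv
    have := huv.2
    simp only [Set.mem_singleton_iff] at this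
    rcases this with h | h
    · exact (key _ _ h).symm
    · exact key _ _ h
  · intro i j hij
    exact Fin.ext (hf.inj i i.2 j j.2 hij)

theorem exists_of_isContained (hℓ : 2 ≤ ℓ)
    (h : (SimpleGraph.cycleGraph ℓ).IsContained G) : ∃ f, IsCycleSeq G ℓ f := by
  obtain ⟨⟨φ, hφ⟩⟩ := h
  obtain ⟨ℓ, rfl⟩ : ∃ m, ℓ = m + 2 := ⟨ℓ - 2, by omega⟩
  have hadj : ∀ i : Fin (ℓ + 2), G.Adj (φ i) (φ (i + 1)) := by
    intro i
    apply φ.map_rel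
    rw [SimpleGraph.cycleGraph_eq_circulantGraph]
    simp [SimpleGraph.circulantGraph]
  refine ⟨fun m => φ (Fin.ofNat (ℓ + 2) m), ⟨?_, ?_, ?_⟩⟩
  · intro m
    simp only
    congr 1
    ext
    simp [Fin.ofNat]
  · intro m hm m' hm' hmm
    have := congrArg Fin.val (hφ hmm)
    simpa [Fin.ofNat, Nat.mod_eq_of_lt hm, Nat.mod_eq_of_lt hm'] using this
  · intro m
    have := hadj (Fin.ofNat (ℓ + 2) m)
    convert this using 2
    ext
    simp [Fin.ofNat, Fin.val_add]

end IsCycleSeq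

/-! ### Peeling bipartite edge sets -/

section Peeling

variable {V : Type*} [Fintype V]

/-- The number of pairs of `F` with first entry `s`. -/
noncomputable def fstDegree (F : Finset (V × V)) (s : V) : ℕ :=
  (Finset.univ.filter fun w => (s, w) ∈ F).card

/-- The number of pairs of `F` with second entry `w`. -/
noncomputable def sndDegree (F : Finset (V × V)) (w : V) : ℕ :=
  (Finset.univ.filter fun s => (s, w) ∈ F).card

/-- A nonempty bipartite edge set of large minimum degrees. -/
structure IsCore (D k : ℕ) (H : Finset (V × V)) : Prop where
  nonempty : H.Nonempty
  lt_fstDegree : ∀ e ∈ H, D < fstDegree H e.1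
  le_sndDegree : ∀ e ∈ H, k ≤ sndDegree H e.2

/-- Either a bipartite edge set has a core, or removing fewer than `k` edges at every second
vertex leaves at most `D` edges at every first vertex. -/
theorem exists_peel (D : ℕ) {k : ℕ} (hk : 0 < k) (F : Finset (V × V)) :
    ∃ O ⊆ F, (∀ w, sndDegree (F \ O) w < k) ∧
      ((∀ s, fstDegree O s ≤ D) ∨ ∃ H ⊆ F, IsCore D k H) := by
  induction F using Finset.strongInduction with
  | H F ih =>
    by_cases hcore : ∃ H ⊆ F, IsCore D k H
    · exact ⟨F, subset_rfl, by simp [sndDegree, hk], Or.inr hcore⟩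
    rcases F.eq_empty_or_nonempty with rfl | hne
    · exact ⟨∅, subset_rfl, by simp [sndDegree, hk], Or.inl (by simp [fstDegree])⟩
    have hF : ¬ IsCore D k F := fun h => hcore ⟨F, subset_rfl, h⟩
    -- Vertices are deleted one at a time. A second vertex of degree below `k` loses its edges,
    -- which stay outside `O`; the edges of a first vertex of degree at most `D` are put into `O`.
    -- Since `F` is not a core, one of the two exists.
    by_cases h1 : ∀ e ∈ F, D < fstDegree F e.1
    · have h2 : ∃ e ∈ F, sndDegree F e.2 < k := by
        by_contra! h2
        exact hF ⟨hne, h1, h2⟩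
      obtain ⟨⟨s, w⟩, he, hw⟩ := h2
      simp only at hw
      obtain ⟨O, hO, hO1, hO2⟩ := ih (F.filter fun e => e.2 ≠ w)
        (Finset.filter_ssubset.2 ⟨_, he, by simp⟩)
      refine ⟨O, hO.trans (Finset.filter_subset _ _), ?_, hO2.imp_right ?_⟩
      · intro w'
        by_cases hww : w' = w
        · subst hww
          refine lt_of_le_of_lt (Finset.card_le_card ?_) hw
          intro s'
          simp only [Finset.mem_filter, Finset.mem_univ, true_and, Finset.mem_sdiff]
          exact And.left
        · refine lt_of_le_of_lt (Finset.card_le_card ?_) (hO1 w')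
          intro s'
          simp +contextual [hww]
      · rintro ⟨H, hH, hc⟩
        exact ⟨H, hH.trans (Finset.filter_subset _ _), hc⟩
    · push Not at h1
      obtain ⟨⟨s, w⟩, he, hs⟩ := h1
      simp only at hs
      obtain ⟨O, hO, hO1, hO2⟩ := ih (F.filter fun e => e.1 ≠ s)
        (Finset.filter_ssubset.2 ⟨_, he, by simp⟩)
      rcases hO2 with hO2 | ⟨H, hH, hc⟩
      swap
      · exact absurd ⟨H, hH.trans (Finset.filter_subset _ _), hc⟩ hcore
      refine ⟨O ∪ F.filter fun e => e.1 = s, Finset.union_subset (hO.trans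
        (Finset.filter_subset _ _)) (Finset.filter_subset _ _), ?_, Or.inl ?_⟩
      · intro w'
        refine lt_of_le_of_lt (Finset.card_le_card ?_) (hO1 w')
        intro s'
        simp only [Finset.mem_filter, Finset.mem_univ, true_and, Finset.mem_sdiff,
          Finset.mem_union]
        tauto
      · intro s'
        by_cases hss : s' = s
        · subst hss
          refine le_trans (Finset.card_le_card ?_) hs
          intro w'
          simp only [Finset.mem_filter, Finset.mem_univ, true_and, Finset.mem_union]
          rintro (h | h)
          · exact Finset.mem_of_mem_filter _ (hO h)
          · exact h.1
        · refine le_trans (Finset.card_le_card ?_) (hO2 s')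
          intro w'
          simp [hss]

/-- The edge set `O` of `exists_peel`. -/
noncomputable def peel (D k : ℕ) (F : Finset (V × V)) : Finset (V × V) :=
  if hk : 0 < k then (exists_peel D hk F).choose else F

theorem peel_subset (D k : ℕ) (F : Finset (V × V)) : peel D k F ⊆ F := by
  unfold peel
  split_ifs with hk
  · exact (exists_peel D hk F).choose_spec.1
  · exact subset_rfl

theorem sndDegree_le_peel (D : ℕ) {k : ℕ} (hk : 0 < k) (F : Finset (V × V)) (w : V) :
    sndDegree F w ≤ sndDegree (peel D k F) w + (k - 1) := by
  have h := (exists_peel D hk F).choose_spec.2.1 w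
  rw [show (exists_peel D hk F).choose = peel D k F by rw [peel, dif_pos hk]] at h
  have h2 : sndDegree F w ≤ sndDegree (peel D k F) w + sndDegree (F \ peel D k F) w := by
    refine le_trans (Finset.card_le_card ?_) (Finset.card_union_le _ _)
    intro s
    simp only [Finset.mem_filter, Finset.mem_univ, true_and, Finset.mem_union, Finset.mem_sdiff]
    tauto
  omega

theorem fstDegree_peel_le (D : ℕ) {k : ℕ} (hk : 0 < k) {F : Finset (V × V)}
    (hF : ¬ ∃ H ⊆ F, IsCore D k H) (s : V) : fstDegree (peel D k F) s ≤ D := by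
  have h := (exists_peel D hk F).choose_spec.2.2.resolve_right hF s
  rwa [show (exists_peel D hk F).choose = peel D k F by rw [peel, dif_pos hk]] at h

/-- A core contains alternating paths. -/
theorem IsCore.exists_alternating {D k : ℕ} {H : Finset (V × V)} (hH : IsCore D k H)
    {G : SimpleGraph V} {S : Finset V} (hadj : ∀ e ∈ H, G.Adj e.1 e.2) (hS : ∀ e ∈ H, e.1 ∈ S)
    (hS' : ∀ e ∈ H, e.2 ∉ S) (hD : k - 1 ≤ D) {e : V × V} (he : e ∈ H) {m : ℕ} (hm : m < k) :
    ∃ (s : V) (l : List V), (s :: l).Nodup ∧ (s :: l).IsChain G.Adj ∧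
      (s :: l).getLast (by simp) = e.2 ∧ ((s :: l).filter (· ∈ S)).length = m + 1 ∧
      ((s :: l).filter (· ∉ S)).length = m + 1 ∧ (∃ w, (s, w) ∈ H) ∧
      ∀ x ∈ s :: l, x ∈ S ∨ ∃ e ∈ H, e.2 = x := by
  induction m with
  | zero =>
    refine ⟨e.1, [e.2], ?_, ?_, ?_, ?_, ?_, ⟨e.2, he⟩, ?_⟩
    · simpa using (hadj e he).ne
    · simpa using hadj e he
    · simp
    · simp [hS e he, hS' e he]
    · simp [hS e he, hS' e he]
    · intro x hx
      simp only [List.mem_cons, List.not_mem_nil, or_false] at hx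
      rcases hx with rfl | rfl
      · exact Or.inl (hS e he)
      · exact Or.inr ⟨e, he, rfl⟩
  | succ m ih =>
    obtain ⟨s, l, hnd, hch, hlast, hl1, hl2, ⟨w, hw⟩, hx⟩ := ih (by omega)
    -- The path is prolonged at its head. Neighbours of `s` in `H` lie outside `S`, so only the `m +
    -- 1 ≤ D` path vertices outside `S` have to be avoided; likewise for `s'` only the `m + 1 < k`
    -- path vertices in `S`.
    obtain ⟨w', hw', hw'l⟩ : ∃ w', (s, w') ∈ H ∧ w' ∉ ((s :: l).filter (· ∉ S)) := by
      have hdeg : D < fstDegree H s := hH.lt_fstDegree _ hw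
      obtain ⟨w', h1, h2⟩ := Finset.exists_mem_notMem_of_card_lt_card
        (s := ((s :: l).filter (· ∉ S)).toFinset) (t := Finset.univ.filter fun w => (s, w) ∈ H)
        (lt_of_le_of_lt (List.toFinset_card_le _) (by rw [fstDegree] at hdeg; omega))
      exact ⟨w', by simpa using h1, by simpa using h2⟩
    obtain ⟨s', hs', hs'l⟩ : ∃ s', (s', w') ∈ H ∧ s' ∉ ((s :: l).filter (· ∈ S)) := by
      have hdeg : k ≤ sndDegree H w' := hH.le_sndDegree _ hw'
      obtain ⟨s', h1, h2⟩ := Finset.exists_mem_notMem_of_card_lt_card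
        (s := ((s :: l).filter (· ∈ S)).toFinset) (t := Finset.univ.filter fun s => (s, w') ∈ H)
        (lt_of_le_of_lt (List.toFinset_card_le _) (by rw [sndDegree] at hdeg; omega))
      exact ⟨s', by simpa using h1, by simpa using h2⟩
    have hwS : w' ∉ S := hS' _ hw'
    have hsS : s' ∈ S := hS _ hs'
    have hw'n : w' ∉ s :: l := fun h => hw'l (by rw [List.mem_filter]; exact ⟨h, by simpa using hwS⟩)
    have hs'n : s' ∉ s :: l := fun h => hs'l (by rw [List.mem_filter]; exact ⟨h, by simpa using hsS⟩)
    refine ⟨s', w' :: s :: l, ?_, ?_, ?_, ?_, ?_, ⟨w', hs'⟩, ?_⟩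
    · rw [List.nodup_cons, List.nodup_cons]
      refine ⟨?_, hw'n, hnd⟩
      rw [List.mem_cons, not_or]
      exact ⟨(hadj _ hs').ne, hs'n⟩
    · exact List.IsChain.cons_cons (hadj _ hs') (List.IsChain.cons_cons (hadj _ hw').symm hch)
    · rw [List.getLast_cons (by simp), List.getLast_cons (by simp), hlast]
    · rw [List.filter_cons_of_pos (by simpa using hsS), List.filter_cons_of_neg (by simpa using hwS),
        List.length_cons, hl1]
    · rw [List.filter_cons_of_neg (by simpa using hsS), List.filter_cons_of_pos (by simpa using hwS),
        List.length_cons, hl2]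
    · intro x hxm
      rw [List.mem_cons, List.mem_cons] at hxm
      rcases hxm with rfl | rfl | h
      · exact Or.inl hsS
      · exact Or.inr ⟨_, hs', rfl⟩
      · exact hx x h

end Peeling

end CycleCombinatorics

/-! ### Layered reachability and the density argument -/

section LayeredReach

open scoped Classical

/-- Two paths through the layers that end in the same vertex `v`, are otherwise disjoint, and whose
starting vertices are joined by a path outside the positive layers form a cycle. -/
theorem exists_cycleSeq_of_layered_paths {V : Type*} {G : SimpleGraph V} {lay : V → ℕ}
    {H : V → Prop} {S : Finset V} (hH : ∀ v, H v → v ∉ S) {i : ℕ} {q q' : ℕ → V}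
    (hend : q (i + 1) = q' (i + 1))
    (hq : ∀ j ≤ i + 1, lay (q j) = j ∧ H (q j)) (hq' : ∀ j ≤ i + 1, lay (q' j) = j ∧ H (q' j))
    (hqadj : ∀ j < i + 1, G.Adj (q j) (q (j + 1)))
    (hqadj' : ∀ j < i + 1, G.Adj (q' j) (q' (j + 1)))
    (hdisj : ∀ j, 1 ≤ j → j ≤ i → q j ≠ q' j)
    {l : List V} (hl : l ≠ []) (hnd : l.Nodup) (hch : l.IsChain G.Adj) (hhead : l.head hl = q' 0)
    (hlast : l.getLast hl = q 0) (hlS : ∀ x ∈ l, x ∈ S ∨ lay x = 0) :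
    ∃ f, IsCycleSeq G (l.length + 2 * i + 1) f ∧ ∀ x ∈ l, ∃ m, f m = x := by
  -- The cycle runs down `q'` from the common end to level `1` (`A`), along `l` from `q' 0` to `q
  -- 0`, and up `q` from level `1` to `i` (`B`); the edge from `q i` to the common end closes it.
  set A : List V := (List.range (i + 1)).map (fun j => q' (i + 1 - j)) with hA
  set B : List V := (List.range i).map (fun j => q (j + 1)) with hB
  have memA : ∀ x, x ∈ A → ∃ j, 1 ≤ j ∧ j ≤ i + 1 ∧ x = q' j := by
    intro x hx
    obtain ⟨j, hj, rfl⟩ := List.mem_map.1 hx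
    rw [List.mem_range] at hj
    exact ⟨i + 1 - j, by omega, by omega, rfl⟩
  have memB : ∀ x, x ∈ B → ∃ j, 1 ≤ j ∧ j ≤ i ∧ x = q j := by
    intro x hx
    obtain ⟨j, hj, rfl⟩ := List.mem_map.1 hx
    rw [List.mem_range] at hj
    exact ⟨j + 1, by omega, by omega, rfl⟩
  have hAne : A ≠ [] := by simp [hA]
  have hAhead : A.head hAne = q' (i + 1) := by simp [hA, List.head_map]
  have hAlast : A.getLast hAne = q' 1 := by simp [hA, List.getLast_map]
  have hne : A ++ (l ++ B) ≠ [] := by simp [hAne]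
  have hchA : A.IsChain G.Adj := by
    rw [List.isChain_iff_getElem]
    intro m hm
    simp only [hA, List.length_map, List.length_range] at hm
    simp only [hA, List.getElem_map, List.getElem_range]
    have := hqadj' (i - m) (by omega)
    rw [show i + 1 - m = i - m + 1 by omega, show i + 1 - (m + 1) = i - m by omega]
    exact this.symm
  have hchB : B.IsChain G.Adj := by
    rw [List.isChain_iff_getElem]
    intro m hm
    simp only [hB, List.length_map, List.length_range] at hm
    simp only [hB, List.getElem_map, List.getElem_range]
    exact hqadj (m + 1) (by omega)
  have hndA : A.Nodup := by
    refine List.Nodup.map_on ?_ List.nodup_range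
    intro x hx y hy hxy
    rw [List.mem_range] at hx hy
    have h1 := (hq' (i + 1 - x) (by omega)).1
    have h2 := (hq' (i + 1 - y) (by omega)).1
    rw [hxy] at h1
    omega
  have hndB : B.Nodup := by
    refine List.Nodup.map_on ?_ List.nodup_range
    intro x hx y hy hxy
    rw [List.mem_range] at hx hy
    have h1 := (hq (x + 1) (by omega)).1
    have h2 := (hq (y + 1) (by omega)).1
    rw [hxy] at h1
    omega
  have hnotl : ∀ x, H x → 1 ≤ lay x → x ∉ l := by
    intro x hx1 hx2 hx
    rcases hlS x hx with h | h
    · exact hH x hx1 h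
    · omega
  have hchain : (A ++ (l ++ B)).IsChain G.Adj := by
    refine List.IsChain.append hchA (List.IsChain.append hch hchB ?_) ?_
    · intro x hx y hy
      rw [List.getLast?_eq_getLast_of_ne_nil hl, Option.mem_some_iff, hlast] at hx
      rw [Option.mem_def, List.head?_eq_some_iff] at hy
      obtain ⟨ys, hy⟩ := hy
      have hi : 0 < i := by
        have := congrArg List.length hy
        simp only [hB, List.length_map, List.length_range, List.length_cons] at this
        omega
      have : y = q 1 := by
        have h := congrArg (fun l => l.head?) hy
        obtain ⟨i, rfl⟩ : ∃ i', i = i' + 1 := ⟨i - 1, by omega⟩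
        simp [hB, List.range_succ_eq_map] at h
        exact h.symm
      rw [← hx, this]
      exact hqadj 0 (by omega)
    · intro x hx y hy
      rw [List.getLast?_eq_getLast_of_ne_nil hAne, Option.mem_some_iff, hAlast] at hx
      rw [List.head?_append_of_ne_nil _ hl, List.head?_eq_some_head hl, Option.mem_some_iff,
        hhead] at hy
      rw [← hx, ← hy]
      exact (hqadj' 0 (by omega)).symm
  have hnodup : (A ++ (l ++ B)).Nodup := by
    rw [List.nodup_append', List.nodup_append']
    refine ⟨hndA, ⟨hnd, hndB, ?_⟩, ?_⟩
    · intro x hxl hxB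
      obtain ⟨j, h1, h2, rfl⟩ := memB x hxB
      exact hnotl _ (hq j (by omega)).2 (by rw [(hq j (by omega)).1]; exact h1) hxl
    · intro x hxA hx
      obtain ⟨j, h1, h2, rfl⟩ := memA x hxA
      rcases List.mem_append.1 hx with hx | hx
      · exact hnotl _ (hq' j (by omega)).2 (by rw [(hq' j (by omega)).1]; exact h1) hx
      · obtain ⟨j', h3, h4, h5⟩ := memB _ hx
        have h6 := (hq' j (by omega)).1
        rw [h5, (hq j' (by omega)).1] at h6
        subst h6
        exact hdisj _ h3 h4 h5.symm
  have hlastadj : G.Adj ((A ++ (l ++ B)).getLast hne) ((A ++ (l ++ B)).head hne) := by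
    rw [List.head_append_of_ne_nil hAne, hAhead, ← hend]
    rcases Nat.eq_zero_or_pos i with rfl | hi
    · have hB0 : B = [] := by simp [hB]
      have : (A ++ (l ++ B)).getLast hne = q 0 := by
        simp only [hB0, List.append_nil]
        rw [List.getLast_append_of_ne_nil _ hl, hlast]
      rw [this]
      exact hqadj 0 (by omega)
    · have hB0 : B ≠ [] := by simp [hB]; omega
      have : (A ++ (l ++ B)).getLast hne = q i := by
        rw [List.getLast_append_of_ne_nil _ (by simp [hl]), List.getLast_append_of_ne_nil _ hB0]
        simp only [hB, List.getLast_map, List.getLast_range]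
        congr 1
        omega
      rw [this]
      exact hqadj i (by omega)
  obtain ⟨f, hf, hfx⟩ := IsCycleSeq.exists_of_list hne hnodup hchain hlastadj
  refine ⟨f, ?_, fun x hx => hfx x (by simp [hx])⟩
  convert hf using 1
  simp only [List.length_append, hA, hB, List.length_map, List.length_range]
  omega

variable {V : Type*} [Fintype V]

/-- The vertices `w` in layer `0`, lying in `X`, that are joined to `v` by a path
`w = v₀, …, vᵢ = v` in `H` whose vertex `vⱼ` is in layer `j`. -/
noncomputable def layeredReach (G : SimpleGraph V) (lay : V → ℕ) (H X : V → Prop) :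
    ℕ → V → Finset V
  | 0, v => if lay v = 0 ∧ H v ∧ X v then {v} else ∅
  | i + 1, v => if lay v = i + 1 ∧ H v then
      Finset.univ.filter fun w => ∃ u, G.Adj v u ∧ w ∈ layeredReach G lay H X i u else ∅

/-- Edges between `S` and the layered reach of a vertex, thinned out by peeling in every layer. -/
noncomputable def layeredEdges (G : SimpleGraph V) (lay : V → ℕ) (H X : V → Prop) (S : Finset V)
    (k : ℕ) : ℕ → V → Finset (V × V)
  | 0, v => if lay v = 0 ∧ H v ∧ X v then
      Finset.univ.filter fun e => e.2 = v ∧ e.1 ∈ S ∧ G.Adj e.1 v else ∅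
  | i + 1, v => if lay v = i + 1 ∧ H v then
      peel (2 ^ i * (k - 1)) k
        (Finset.univ.filter fun e => ∃ u, G.Adj v u ∧ e ∈ layeredEdges G lay H X S k i u) else ∅

variable {G : SimpleGraph V} {lay : V → ℕ} {H X : V → Prop} {S : Finset V} {k : ℕ}

theorem mem_layeredReach_zero {v w : V} :
    w ∈ layeredReach G lay H X 0 v ↔ w = v ∧ lay v = 0 ∧ H v ∧ X v := by
  rw [layeredReach]
  split_ifs with h <;> simp [h]

theorem mem_layeredReach_succ {i : ℕ} {v w : V} :
    w ∈ layeredReach G lay H X (i + 1) v ↔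
      (lay v = i + 1 ∧ H v) ∧ ∃ u, G.Adj v u ∧ w ∈ layeredReach G lay H X i u := by
  rw [layeredReach]
  split_ifs with h <;> simp [h]

theorem source_of_mem_layeredReach {i : ℕ} {v w : V} (h : w ∈ layeredReach G lay H X i v) :
    lay w = 0 ∧ H w ∧ X w := by
  induction i generalizing v with
  | zero =>
    obtain ⟨rfl, h⟩ := mem_layeredReach_zero.1 h
    exact h
  | succ i ih =>
    obtain ⟨-, u, -, hu⟩ := mem_layeredReach_succ.1 h
    exact ih hu

theorem exists_path_of_mem_layeredReach {i : ℕ} {v w : V} (h : w ∈ layeredReach G lay H X i v) :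
    ∃ q : ℕ → V, q i = v ∧ q 0 = w ∧ (∀ j ≤ i, lay (q j) = j) ∧
      ∀ j < i, G.Adj (q j) (q (j + 1)) := by
  induction i generalizing v with
  | zero =>
    obtain ⟨rfl, h, -⟩ := mem_layeredReach_zero.1 h
    exact ⟨fun _ => w, rfl, rfl, by simpa using h, by simp⟩
  | succ i ih =>
    obtain ⟨⟨hv, -⟩, u, huv, hu⟩ := mem_layeredReach_succ.1 h
    obtain ⟨q, rfl, rfl, h1, h2⟩ := ih hu
    refine ⟨Function.update q (i + 1) v, by simp, by simp, ?_, ?_⟩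
    · intro j hj
      rcases hj.lt_or_eq with hj | rfl
      · rw [Function.update_of_ne hj.ne]
        exact h1 j (by omega)
      · simpa using hv
    · intro j hj
      rw [Function.update_of_ne hj.ne]
      rcases (Nat.lt_succ_iff.1 hj).lt_or_eq with hj | rfl
      · rw [Function.update_of_ne (by omega)]
        exact h2 j hj
      · simpa using huv.symm

theorem mem_layeredEdges_zero {v : V} {e : V × V} :
    e ∈ layeredEdges G lay H X S k 0 v ↔
      (lay v = 0 ∧ H v ∧ X v) ∧ e.2 = v ∧ e.1 ∈ S ∧ G.Adj e.1 v := by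
  rw [layeredEdges]
  split_ifs with h <;> simp [h]

theorem layeredEdges_succ_spec {i : ℕ} {v : V} {e : V × V}
    (h : e ∈ layeredEdges G lay H X S k (i + 1) v) :
    (lay v = i + 1 ∧ H v) ∧ ∃ u, G.Adj v u ∧ e ∈ layeredEdges G lay H X S k i u := by
  rw [layeredEdges] at h
  split_ifs at h with hv
  · have := peel_subset _ _ _ h
    simp only [Finset.mem_filter, Finset.mem_univ, true_and] at this
    exact ⟨hv, this⟩
  · simp at h

theorem layer_of_mem_layeredEdges {i : ℕ} {v : V} {e : V × V}
    (h : e ∈ layeredEdges G lay H X S k i v) : lay v = i ∧ H v := by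
  cases i with
  | zero => exact ⟨(mem_layeredEdges_zero.1 h).1.1, (mem_layeredEdges_zero.1 h).1.2.1⟩
  | succ i => exact (layeredEdges_succ_spec h).1

theorem edge_of_mem_layeredEdges {i : ℕ} {v : V} {e : V × V}
    (h : e ∈ layeredEdges G lay H X S k i v) : e.1 ∈ S ∧ G.Adj e.1 e.2 ∧ lay e.2 = 0 ∧ H e.2 := by
  induction i generalizing v with
  | zero =>
    obtain ⟨⟨h1, h2, -⟩, rfl, h3, h4⟩ := mem_layeredEdges_zero.1 h
    exact ⟨h3, h4, h1, h2⟩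
  | succ i ih =>
    obtain ⟨-, u, -, hu⟩ := layeredEdges_succ_spec h
    exact ih hu

/-- An edge in the layered edge set of a vertex comes with a path through the layers to that
vertex along which it is never peeled off. -/
theorem exists_path_of_mem_layeredEdges {i : ℕ} {v : V} {e : V × V}
    (h : e ∈ layeredEdges G lay H X S k i v) :
    ∃ q : ℕ → V, q i = v ∧ q 0 = e.2 ∧ (∀ j ≤ i, e ∈ layeredEdges G lay H X S k j (q j)) ∧
      ∀ j < i, G.Adj (q j) (q (j + 1)) := by
  induction i generalizing v with
  | zero =>
    have := (mem_layeredEdges_zero.1 h).2.1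
    exact ⟨fun _ => v, rfl, this.symm, by simpa using h, by simp⟩
  | succ i ih =>
    obtain ⟨-, u, huv, hu⟩ := layeredEdges_succ_spec h
    obtain ⟨q, rfl, h0, h1, h2⟩ := ih hu
    refine ⟨Function.update q (i + 1) v, by simp, by simpa using h0, ?_, ?_⟩
    · intro j hj
      rcases hj.lt_or_eq with hj | rfl
      · rw [Function.update_of_ne hj.ne]
        exact h1 j (by omega)
      · simpa using h
    · intro j hj
      rw [Function.update_of_ne hj.ne]
      rcases (Nat.lt_succ_iff.1 hj).lt_or_eq with hj | rfl
      · rw [Function.update_of_ne (by omega)]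
        exact h2 j hj
      · simpa using huv.symm

theorem sum_two_pow_mul (i c : ℕ) : ∑ l ∈ Finset.range i, 2 ^ l * c + c = 2 ^ i * c := by
  induction i with
  | zero => simp
  | succ i ih => rw [Finset.sum_range_succ]; ring_nf at ih ⊢; omega

/-- If no `2k`-cycle meets `S`, peeling bounds the degrees of the layered edge sets. -/
theorem fstDegree_layeredEdges_le (hH : ∀ v, H v → v ∉ S)
    (hcyc : ∀ f, IsCycleSeq G (2 * k) f → ∀ m, f m ∉ S) {i : ℕ} (hi : i + 1 < k) (v s : V) :
    fstDegree (layeredEdges G lay H X S k (i + 1) v) s ≤ 2 ^ i * (k - 1) := by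
  induction i using Nat.strong_induction_on generalizing v s with
  | _ i ih =>
  rw [layeredEdges]
  split_ifs with hv
  swap
  · simp [fstDegree]
  refine fstDegree_peel_le _ (by omega) ?_ s
  rintro ⟨C, hC, hcore⟩
  have hmem : ∀ e ∈ C, ∃ u, G.Adj v u ∧ e ∈ layeredEdges G lay H X S k i u := fun e he => by
    simpa using hC he
  have hpath : ∀ e ∈ C, ∃ q : ℕ → V, q (i + 1) = v ∧ q 0 = e.2 ∧
      (∀ j ≤ i, e ∈ layeredEdges G lay H X S k j (q j)) ∧
      (∀ j < i + 1, G.Adj (q j) (q (j + 1))) ∧ ∀ j ≤ i + 1, lay (q j) = j ∧ H (q j) := by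
    intro e he
    obtain ⟨u, huv, hu⟩ := hmem e he
    obtain ⟨q, rfl, h0, h1, h2⟩ := exists_path_of_mem_layeredEdges hu
    refine ⟨Function.update q (i + 1) v, by simp, by simpa using h0, ?_, ?_, ?_⟩
    · intro j hj
      rw [Function.update_of_ne (by omega)]
      exact h1 j hj
    · intro j hj
      rw [Function.update_of_ne (by omega)]
      rcases (Nat.lt_succ_iff.1 hj).lt_or_eq with hj | rfl
      · rw [Function.update_of_ne (by omega)]
        exact h2 j hj
      · simpa using huv.symm
    · intro j hj
      rcases hj.lt_or_eq with hj | rfl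
      · rw [Function.update_of_ne hj.ne]
        exact layer_of_mem_layeredEdges (h1 j (by omega))
      · simpa using hv
  have hedge : ∀ e ∈ C, e.1 ∈ S ∧ G.Adj e.1 e.2 ∧ lay e.2 = 0 ∧ H e.2 := by
    intro e he
    obtain ⟨u, -, hu⟩ := hmem e he
    exact edge_of_mem_layeredEdges hu
  obtain ⟨e₀, he₀⟩ := hcore.nonempty
  have hone : 1 * (k - 1) ≤ 2 ^ i * (k - 1) := Nat.mul_le_mul_right _ Nat.one_le_two_pow
  -- The alternating path has `k - i - 1` vertices in `S` and as many outside. One further source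
  -- `w'` and the `2 * i + 1` vertices in the positive layers bring the length to `2 * k`.
  obtain ⟨s, l, hnd, hch, hlast, hl1, hl2, ⟨w, hw⟩, hl⟩ :=
    hcore.exists_alternating (fun e he => (hedge e he).2.1) (fun e he => (hedge e he).1)
      (fun e he => hH _ (hedge e he).2.2.2) (by omega) he₀ (m := k - i - 2) (by omega)
  obtain ⟨q, hqv, hq0, hqe, hqadj, hqlay⟩ := hpath e₀ he₀
  -- If the path of `w'` met `q` at a level between `1` and `i`, the edge `(s, w')` would lie in the
  -- edge set of that vertex of `q`. By induction few `w'` have this property.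
  set bad : Finset V := (Finset.range i).biUnion fun j =>
    Finset.univ.filter fun w => (s, w) ∈ layeredEdges G lay H X S k (j + 1) (q (j + 1)) with hbad
  have hbadcard : bad.card ≤ ∑ j ∈ Finset.range i, 2 ^ j * (k - 1) := by
    refine Finset.card_biUnion_le.trans (Finset.sum_le_sum fun j hj => ?_)
    rw [Finset.mem_range] at hj
    exact ih j hj (by omega) _ _
  obtain ⟨w', hw', hw'n⟩ : ∃ w', (s, w') ∈ C ∧ w' ∉ bad ∪ ((s :: l).filter (· ∉ S)).toFinset := by
    -- At most `(2 ^ i - 1) * (k - 1)` choices are bad and at most `k - 1` lie on the path; this is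
    -- where the peeling bound `2 ^ i * (k - 1)` comes from.
    have hdeg : 2 ^ i * (k - 1) < fstDegree C s := hcore.lt_fstDegree _ hw
    have hsum := sum_two_pow_mul i (k - 1)
    have h3 := List.toFinset_card_le ((s :: l).filter (· ∉ S))
    obtain ⟨w', h1, h2⟩ := Finset.exists_mem_notMem_of_card_lt_card
      (s := bad ∪ ((s :: l).filter (· ∉ S)).toFinset)
      (t := Finset.univ.filter fun w => (s, w) ∈ C)
      (lt_of_le_of_lt (Finset.card_union_le _ _) (by rw [fstDegree] at hdeg; omega))
    exact ⟨w', by simpa using h1, h2⟩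
  rw [Finset.mem_union, not_or] at hw'n
  have hw'S : w' ∉ S := hH _ (hedge _ hw').2.2.2
  have hw'l : w' ∉ s :: l := fun h => hw'n.2 (by
    rw [List.mem_toFinset, List.mem_filter]; exact ⟨h, by simpa using hw'S⟩)
  obtain ⟨q', hqv', hq0', hqe', hqadj', hqlay'⟩ := hpath _ hw'
  have hdisj : ∀ j, 1 ≤ j → j ≤ i → q j ≠ q' j := by
    intro j hj1 hj2 hjq
    obtain ⟨j, rfl⟩ : ∃ j', j = j' + 1 := ⟨j - 1, by omega⟩
    apply hw'n.1
    rw [hbad, Finset.mem_biUnion]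
    refine ⟨j, Finset.mem_range.2 (by omega), ?_⟩
    rw [Finset.mem_filter, hjq]
    exact ⟨Finset.mem_univ _, hqe' _ hj2⟩
  have hlS : ∀ x ∈ w' :: s :: l, x ∈ S ∨ lay x = 0 := by
    intro x hx
    rw [List.mem_cons] at hx
    rcases hx with rfl | hx
    · exact Or.inr (hedge _ hw').2.2.1
    · exact (hl x hx).imp_right fun ⟨e, he, h⟩ => h ▸ (hedge e he).2.2.1
  obtain ⟨f, hf, hfm⟩ := exists_cycleSeq_of_layered_paths (l := w' :: s :: l) hH
    (hqv.trans hqv'.symm) hqlay hqlay' hqadj hqadj' hdisj (by simp)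
    (List.nodup_cons.2 ⟨hw'l, hnd⟩) (List.IsChain.cons_cons (hedge _ hw').2.1.symm hch)
    (by simpa using hq0'.symm) (by rw [List.getLast_cons (by simp), hlast, hq0]) hlS
  have hlen : (w' :: s :: l).length + 2 * i + 1 = 2 * k := by
    have h1 : (s :: l).length = ((s :: l).filter (· ∈ S)).length +
        ((s :: l).filter (· ∉ S)).length := by
      rw [List.length_eq_length_filter_add (l := s :: l) (· ∈ S)]
      congr 2
      apply List.filter_congr
      simp
    rw [List.length_cons, h1, hl1, hl2]
    omega
  rw [hlen] at hf
  obtain ⟨m, hm⟩ := hfm s (by simp)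
  exact hcyc f hf m (by rw [hm]; exact (hedge _ hw').1)

/-- A source starts with `k ^ 2` edges to `S`, and along a path that carries it to `v` each of the
`i` peelings discards at most `k - 1` of them. -/
theorem le_sndDegree_layeredEdges (hk : 0 < k)
    (hX : ∀ v, X v → k ^ 2 ≤ (Finset.univ.filter fun s => s ∈ S ∧ G.Adj s v).card)
    {i : ℕ} {v w : V} (h : w ∈ layeredReach G lay H X i v) :
    k ^ 2 ≤ sndDegree (layeredEdges G lay H X S k i v) w + i * (k - 1) := by
  induction i generalizing v with
  | zero =>
    obtain ⟨rfl, h⟩ := mem_layeredReach_zero.1 h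
    rw [zero_mul, add_zero]
    refine (hX w h.2.2).trans (Finset.card_le_card ?_)
    intro s
    simp [mem_layeredEdges_zero, h]
  | succ i ih =>
    obtain ⟨hv, u, huv, hu⟩ := mem_layeredReach_succ.1 h
    rw [layeredEdges, if_pos hv]
    have h1 := sndDegree_le_peel (2 ^ i * (k - 1)) hk (Finset.univ.filter fun e =>
      ∃ u, G.Adj v u ∧ e ∈ layeredEdges G lay H X S k i u) w
    have h2 : sndDegree (layeredEdges G lay H X S k i u) w ≤ sndDegree (Finset.univ.filter fun e =>
        ∃ u, G.Adj v u ∧ e ∈ layeredEdges G lay H X S k i u) w := by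
      refine Finset.card_le_card ?_
      intro s
      simp only [Finset.mem_filter, Finset.mem_univ, true_and]
      exact fun h => ⟨u, huv, h⟩
    have h3 := ih hu
    rw [Nat.succ_mul]
    omega

/-- If every source has at least `k ^ 2` neighbours in `S`, and no `2k`-cycle meets `S`, then
few sources reach any given vertex through the layers outside `S`. -/
theorem card_layeredReach_le (hH : ∀ v, H v → v ∉ S)
    (hX : ∀ v, X v → k ^ 2 ≤ (Finset.univ.filter fun s => s ∈ S ∧ G.Adj s v).card)
    (hcyc : ∀ f, IsCycleSeq G (2 * k) f → ∀ m, f m ∉ S) {i : ℕ} (hi : i + 1 < k) (v : V) :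
    (layeredReach G lay H X (i + 1) v).card ≤ S.card * (2 ^ i * (k - 1)) := by
  refine le_trans (Finset.card_le_card ?_) (Finset.card_biUnion_le_card_mul S
    (fun s => Finset.univ.filter fun w => (s, w) ∈ layeredEdges G lay H X S k (i + 1) v) _
    fun s _ => fstDegree_layeredEdges_le hH hcyc hi v s)
  intro w hw
  have h1 := le_sndDegree_layeredEdges (by omega) hX hw
  -- Fewer than `k` peelings cannot exhaust `k ^ 2` edges, so every source keeps an edge to `S`, and
  -- the sources can be counted from `S`.
  have h2 : (i + 1) * (k - 1) < k ^ 2 := by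
    rw [pow_two]
    exact Nat.mul_lt_mul_of_lt_of_le hi (by omega) (by omega)
  have h3 : 0 < sndDegree (layeredEdges G lay H X S k (i + 1) v) w := by omega
  obtain ⟨s, hs⟩ := Finset.card_pos.1 h3
  simp only [Finset.mem_filter, Finset.mem_univ, true_and] at hs
  rw [Finset.mem_biUnion]
  exact ⟨s, (edge_of_mem_layeredEdges hs).1, by simpa using hs⟩

/-- Each step back towards the sources leaves a vertex of `H`, hence has at most `d` choices. -/
theorem card_layeredReach_le_pow {d : ℕ} (hd : ∀ v, H v → G.degree v ≤ d) (i : ℕ) (v : V) :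
    (layeredReach G lay H X i v).card ≤ d ^ i := by
  induction i generalizing v with
  | zero =>
    rw [layeredReach]
    split_ifs <;> simp
  | succ i ih =>
    rw [layeredReach]
    split_ifs with hv
    · have : (Finset.univ.filter fun w => ∃ u, G.Adj v u ∧ w ∈ layeredReach G lay H X i u) =
          (G.neighborFinset v).biUnion fun u => layeredReach G lay H X i u := by
        ext w
        simp
      rw [this, pow_succ']
      refine (Finset.card_biUnion_le_card_mul _ _ _ fun u _ => ih u).trans ?_
      exact Nat.mul_le_mul_right _ (hd v hv.2)
    · simp

end LayeredReach

/-! ### The flooding protocol: soundness and detectable cycles -/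

section EvenCycleProtocol

open scoped Classical

/-- The seed of a node: whether it is selected, and its colours in `K` colourings. -/
abbrev ColorSeed (k K : ℕ) : Type := Bool × (Fin K → Fin (2 * k))

namespace EvenCycle

variable {k K : ℕ}

/-- The colour of a node in the `r`-th colouring. -/
def color (x : LocalInput (ColorSeed k K)) (r : ℕ) : ℕ :=
  if h : r < K then x.seed.2 ⟨r, h⟩ else 0

/-- The layer of a node in the `j`-th flood: floods run alternately through increasing and through
decreasing colours. -/
def layer (j : ℕ) (x : LocalInput (ColorSeed k K)) : ℕ :=
  if j % 2 = 0 then color x (j / 6) else (2 * k - color x (j / 6)) % (2 * k)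

/-- Whether a node takes part in the `j`-th flood, which is confined to the nodes of small degree,
unrestricted, or confined to the nodes that are not selected, according to `j % 6 / 2`. -/
def Active (n j : ℕ) (x : LocalInput (ColorSeed k K)) : Prop :=
  (j % 6 / 2 = 0 → x.deg ^ k ≤ n) ∧ (j % 6 / 2 = 2 → x.seed.1 = false)

/-- Whether a node is a source of the `j`-th flood, given the number `c` of its selected
neighbours. -/
def Source (j : ℕ) (x : LocalInput (ColorSeed k K)) (c : ℕ) : Prop :=
  (j % 6 / 2 = 1 → x.seed.1 = true) ∧ (j % 6 / 2 = 2 → k ^ 2 ≤ c)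

/-- At step `0` the selected nodes announce themselves; at step `1 + j * k + i` the nodes in layer
`i` of the `j`-th flood forward the identifiers that have reached them, unless these are too
many. -/
noncomputable def protocol (n M : ℕ) : BroadcastProtocol (ColorSeed k K) := fun x hist t =>
  if t = 0 then (if x.seed.1 = true then [0] else [])
  else if layer ((t - 1) / k) x = (t - 1) % k ∧ Active n ((t - 1) / k) x then
    if (t - 1) % k = 0 then
      (if Source ((t - 1) / k) x (hist 0).length then [x.ident] else [])
    else if (hist (t - 1)).dedup.length ≤ 2 ^ ((t - 1) % k) * k * M then (hist (t - 1)).dedup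
    else []
  else []

/-- The bound on the length of the lists sent at a given step. -/
def stepLength (k M : ℕ) (t : ℕ) : ℕ := if t = 0 then 1 else 2 ^ ((t - 1) % k) * k * M

/-- A node rejects if it is opposite to the sources in some colouring, and the same identifier has
reached it from both sides. -/
def Rejects (x : LocalInput (ColorSeed k K)) (hist : ℕ → List ℕ) : Prop :=
  ∃ r < K, color x r = k ∧ ∃ y < 3, ∃ c, c ∈ hist (1 + (6 * r + 2 * y) * k + (k - 1)) ∧
    c ∈ hist (1 + (6 * r + 2 * y + 1) * k + (k - 1))

/-- The number of steps of the protocol. -/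
def steps (k K : ℕ) : ℕ := 1 + 6 * K * k

open BroadcastProtocol

variable {n a M : ℕ} {N : Network n a} {ω : Fin n → ColorSeed k K}

theorem one_le_stepLength (hk : 0 < k) (hM : 0 < M) (t : ℕ) : 1 ≤ stepLength k M t := by
  unfold stepLength
  split_ifs
  · exact le_rfl
  · exact Nat.mul_pos (Nat.mul_pos (Nat.two_pow_pos _) hk) hM

theorem length_sent_le (hk : 0 < k) (hM : 0 < M) (t : ℕ) (v : Fin n) :
    ((protocol n M).sent N ω t v).length ≤ stepLength k M t := by
  have h := one_le_stepLength hk hM t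
  rw [sent, protocol]
  split_ifs with h1 h2 h3 h4 h5 h6
  all_goals try simp only [List.length_nil, List.length_singleton]
  all_goals first | omega | skip
  rw [stepLength, if_neg h1]
  exact h6

/-- Ensures that all entries fit the fixed encoding width; `0` is the announcement of a selected
node. -/
theorem mem_sent_ident {t : ℕ} {v : Fin n} {x : ℕ} (h : x ∈ (protocol n M).sent N ω t v) :
    x = 0 ∨ ∃ u, x = N.ident u := by
  induction t using Nat.strong_induction_on generalizing v with
  | _ t ih =>
  rw [sent, protocol] at h
  split_ifs at h with h1 h2 h3 h4 h5 h6
  · exact Or.inl (by simpa using h)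
  · simp at h
  · exact Or.inr ⟨v, by simpa [input] using h⟩
  · simp at h
  · rw [List.mem_dedup, hist_of_lt _ _ _ (by omega), mem_received] at h
    obtain ⟨u, -, hu⟩ := h
    exact ih _ (by omega) hu
  · simp at h
  · simp at h

theorem sent_zero (v : Fin n) :
    (protocol n M).sent N ω 0 v = if (ω v).1 = true then [0] else [] := rfl

theorem length_received_zero (v : Fin n) :
    ((protocol n M).received N ω 0 v).length =
      (Finset.univ.filter fun s => (ω s).1 = true ∧ N.graph.Adj s v).card := by
  rw [length_received, Finset.card_eq_sum_ones, Finset.sum_filter]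
  rw [show N.graph.neighborFinset v = Finset.univ.filter fun s => N.graph.Adj s v by
    ext s; simp [SimpleGraph.adj_comm], Finset.sum_filter]
  refine Finset.sum_congr rfl fun s _ => ?_
  rw [sent_zero]
  by_cases h1 : (ω s).1 = true <;> by_cases h2 : N.graph.Adj s v <;> simp [h1, h2]

/-- The vertices whose identifiers can reach `v` at level `i` of the `j`-th flood. -/
noncomputable def floodReach (N : Network n a) (ω : Fin n → ColorSeed k K) (j : ℕ) :
    ℕ → Fin n → Finset (Fin n) :=
  layeredReach N.graph (fun v => layer j (input N ω v)) (fun v => Active n j (input N ω v))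
    (fun v => Source j (input N ω v)
      (Finset.univ.filter fun s => (ω s).1 = true ∧ N.graph.Adj s v).card)

theorem sent_level_zero (hk : 0 < k) (j : ℕ) (v : Fin n) :
    (protocol n M).sent N ω (1 + j * k) v =
      if layer j (input N ω v) = 0 ∧ Active n j (input N ω v) then
        (if Source j (input N ω v)
          (Finset.univ.filter fun s => (ω s).1 = true ∧ N.graph.Adj s v).card
        then [N.ident v] else [])
      else [] := by
  have h1 : (1 + j * k - 1) / k = j := by
    rw [Nat.add_sub_cancel_left, Nat.mul_div_cancel _ hk]
  have h2 : (1 + j * k - 1) % k = 0 := by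
    rw [Nat.add_sub_cancel_left, Nat.mul_mod_left]
  rw [sent, protocol, if_neg (by omega), h1, h2, hist_of_lt _ _ _ (by omega),
    length_received_zero, if_pos rfl]
  rfl

theorem sent_level_succ {i : ℕ} (hi : i + 1 < k) (j : ℕ) (v : Fin n) :
    (protocol n M).sent N ω (1 + j * k + (i + 1)) v =
      if layer j (input N ω v) = i + 1 ∧ Active n j (input N ω v) then
        (if ((protocol n M).received N ω (1 + j * k + i) v).dedup.length ≤ 2 ^ (i + 1) * k * M
        then ((protocol n M).received N ω (1 + j * k + i) v).dedup else [])
      else [] := by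
  have h0 : 1 + j * k + (i + 1) - 1 = 1 + j * k + i := by omega
  have h0' : 1 + j * k + (i + 1) - 1 = (i + 1) + j * k := by omega
  have h1 : (1 + j * k + (i + 1) - 1) / k = j := by
    rw [h0', Nat.add_mul_div_right _ _ (by omega), Nat.div_eq_of_lt hi, zero_add]
  have h2 : (1 + j * k + (i + 1) - 1) % k = i + 1 := by
    rw [h0', Nat.add_mul_mod_self_right, Nat.mod_eq_of_lt hi]
  rw [sent, protocol, if_neg (by omega), h1, h2, h0,
    hist_of_lt _ _ _ (show 1 + j * k + i < 1 + j * k + (i + 1) by omega),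
    if_neg (Nat.succ_ne_zero i)]

/-- Holds without any bound on the floods, because cutting off only removes identifiers. -/
theorem mem_floodReach_of_mem_sent {i : ℕ} (hi : i < k) {j : ℕ} {v : Fin n} {x : ℕ}
    (h : x ∈ (protocol n M).sent N ω (1 + j * k + i) v) :
    ∃ w ∈ floodReach N ω j i v, N.ident w = x := by
  induction i generalizing v with
  | zero =>
    rw [add_zero, sent_level_zero (by omega)] at h
    split_ifs at h with h1 h2
    · exact ⟨v, mem_layeredReach_zero.2 ⟨rfl, h1.1, h1.2, h2⟩, by simpa [eq_comm] using h⟩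
    · simp at h
    · simp at h
  | succ i ih =>
    rw [sent_level_succ hi] at h
    split_ifs at h with h1 h2
    · rw [List.mem_dedup, mem_received] at h
      obtain ⟨u, huv, hu⟩ := h
      obtain ⟨w, hw, hx⟩ := ih (by omega) hu
      exact ⟨w, mem_layeredReach_succ.2 ⟨h1, u, huv, hw⟩, hx⟩
    · simp at h
    · simp at h

/-- Everything a node receives comes from its layered reach, so a bound on the reach keeps the list
below the threshold and nothing is lost. -/
theorem ident_mem_sent {j : ℕ}
    (hcard : ∀ i < k, ∀ v, (floodReach N ω j i v).card ≤ 2 ^ i * k * M) {i : ℕ} (hi : i < k)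
    {v w : Fin n} (hw : w ∈ floodReach N ω j i v) :
    N.ident w ∈ (protocol n M).sent N ω (1 + j * k + i) v := by
  induction i generalizing v with
  | zero =>
    obtain ⟨rfl, h1, h2, h3⟩ := mem_layeredReach_zero.1 hw
    rw [add_zero, sent_level_zero (by omega), if_pos ⟨h1, h2⟩, if_pos h3]
    simp
  | succ i ih =>
    obtain ⟨h1, u, huv, hu⟩ := mem_layeredReach_succ.1 hw
    rw [sent_level_succ hi, if_pos h1, if_pos, List.mem_dedup, mem_received]
    · exact ⟨u, huv, ih (by omega) hu⟩
    · rw [← List.card_toFinset]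
      refine le_trans (le_trans (Finset.card_le_card ?_)
        (Finset.card_image_le (f := N.ident))) (hcard _ hi v)
      intro x hx
      rw [List.mem_toFinset, mem_received] at hx
      obtain ⟨u', huv', hu'⟩ := hx
      obtain ⟨w', hw', rfl⟩ := mem_floodReach_of_mem_sent (by omega) hu'
      exact Finset.mem_image_of_mem _ (mem_layeredReach_succ.2 ⟨h1, u', huv', hw'⟩)

theorem color_lt (hk : 0 < k) (x : LocalInput (ColorSeed k K)) (r : ℕ) : color x r < 2 * k := by
  unfold color
  split_ifs
  · exact Fin.is_lt _
  · omega

theorem layer_ascending {r y : ℕ} (hy : y < 3) (x : LocalInput (ColorSeed k K)) :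
    layer (6 * r + 2 * y) x = color x r := by
  rw [layer, if_pos (by omega), show (6 * r + 2 * y) / 6 = r by omega]

theorem layer_descending {r y : ℕ} (hy : y < 3) (x : LocalInput (ColorSeed k K)) :
    layer (6 * r + 2 * y + 1) x = (2 * k - color x r) % (2 * k) := by
  rw [layer, if_neg (by omega), show (6 * r + 2 * y + 1) / 6 = r by omega]

theorem step_lt_steps {r y : ℕ} (hk : 0 < k) (hr : r < K) (hy : y < 3) :
    1 + (6 * r + 2 * y + 1) * k + (k - 1) < steps k K := by
  have : (6 * r + 2 * y + 1 + 1) * k ≤ 6 * K * k := Nat.mul_le_mul_right _ (by omega)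
  rw [Nat.succ_mul] at this
  unfold steps
  omega

/-- A node rejects only if there is a cycle of length `2k`. -/
theorem isContained_of_rejects (hk : 2 ≤ k) {v : Fin n}
    (h : Rejects (input N ω v) ((protocol n M).hist N ω (steps k K) v)) :
    (SimpleGraph.cycleGraph (2 * k)).IsContained N.graph := by
  obtain ⟨r, hr, hcol, y, hy, c, h1, h2⟩ := h
  have hstep := step_lt_steps (by omega) hr hy (k := k)
  rw [hist_of_lt _ _ _ hstep, mem_received] at h2
  rw [Nat.succ_mul] at hstep
  rw [hist_of_lt _ _ _ (by omega), mem_received] at h1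
  obtain ⟨u, huv, hu⟩ := h1
  obtain ⟨u', huv', hu'⟩ := h2
  obtain ⟨w, hw, rfl⟩ := mem_floodReach_of_mem_sent (by omega) hu
  obtain ⟨w', hw', hww⟩ := mem_floodReach_of_mem_sent (by omega) hu'
  obtain rfl := N.ident_injective hww
  obtain ⟨q, rfl, hq0, hq, hqadj⟩ := exists_path_of_mem_layeredReach hw
  obtain ⟨q', rfl, hq0', hq', hqadj'⟩ := exists_path_of_mem_layeredReach hw'
  simp only [layer_ascending hy] at hq
  simp only [layer_descending hy] at hq'
  have hcq' : ∀ j, 1 ≤ j → j ≤ k - 1 → color (input N ω (q' j)) r = 2 * k - j := by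
    intro j hj1 hj2
    have h3 := hq' j hj2
    have h4 := color_lt (by omega) (input N ω (q' j)) r
    rcases Nat.eq_zero_or_pos (color (input N ω (q' j)) r) with h5 | h5
    · rw [h5, Nat.sub_zero, Nat.mod_self] at h3
      omega
    · rw [Nat.mod_eq_of_lt (by omega)] at h3
      omega
  -- Ascending path, `v`, then the descending path backwards. The vertex at position `m` has colour
  -- `m`, which gives injectivity at once.
  set g : ℕ → Fin n := fun m => if m < k then q m else if m = k then v else q' (2 * k - m) with hg
  have hgcol : ∀ m < 2 * k, color (input N ω (g m)) r = m := by
    intro m hm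
    simp only [hg]
    split_ifs with h3 h4
    · exact hq m (by omega)
    · rw [hcol, h4]
    · rw [hcq' _ (by omega) (by omega)]
      omega
  have hf : IsCycleSeq N.graph (2 * k) (fun m => g (m % (2 * k))) := by
    refine IsCycleSeq.of_lt (by omega) ?_ ?_ ?_
    · intro m hm m' hm' h
      rw [← hgcol m hm, ← hgcol m' hm', h]
    · intro m hm
      simp only [hg]
      rcases lt_trichotomy (m + 1) k with h3 | h3 | h3
      · rw [if_pos (by omega), if_pos h3]
        exact hqadj m (by omega)
      · rw [if_pos (by omega), if_neg (by omega), if_pos h3, show m = k - 1 by omega]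
        exact huv.symm
      · rw [if_neg (show ¬ m < k by omega), if_neg (show ¬ m + 1 < k by omega),
          if_neg (show ¬ m + 1 = k by omega)]
        split_ifs with h4
        · rw [show 2 * k - (m + 1) = k - 1 by omega]
          exact huv'
        · have := hqadj' (2 * k - (m + 1)) (by omega)
          rw [show 2 * k - (m + 1) + 1 = 2 * k - m by omega] at this
          exact this.symm
    · simp only [hg]
      rw [if_neg (by omega), if_neg (by omega), if_pos (by omega), hq0, ← hq0',
        show 2 * k - (2 * k - 1) = 0 + 1 by omega]
      exact (hqadj' 0 (by omega)).symm
  rw [show 2 * k = (2 * k - 1) + 1 by omega] at hf ⊢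
  exact hf.isContained

/-- A cycle coloured consecutively is detected, if the floods starting from its first vertex
can reach all of it and are never cut off. -/
theorem rejects_of_wellColored {f : ℕ → Fin n} (hf : IsCycleSeq N.graph (2 * k) f)
    {r y : ℕ} (hr : r < K) (hy : y < 3) (hk : 0 < k)
    (hcol : ∀ m < 2 * k, color (input N ω (f m)) r = m)
    (hact : ∀ m, Active n (2 * y) (input N ω (f m)))
    (hsrc : Source (2 * y) (input N ω (f 0))
      (Finset.univ.filter fun s => (ω s).1 = true ∧ N.graph.Adj s (f 0)).card)
    (hcard : ∀ j, j % 6 / 2 = y → ∀ i < k, ∀ v, (floodReach N ω j i v).card ≤ 2 ^ i * k * M) :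
    Rejects (input N ω (f k)) ((protocol n M).hist N ω (steps k K) (f k)) := by
  have hA : ∀ j, j % 6 / 2 = y → ∀ m, Active n j (input N ω (f m)) := by
    intro j hj m
    have := hact m
    rw [Active, show 2 * y % 6 / 2 = y by omega] at this
    rwa [Active, hj]
  have hX : ∀ j, j % 6 / 2 = y → Source j (input N ω (f 0))
      (Finset.univ.filter fun s => (ω s).1 = true ∧ N.graph.Adj s (f 0)).card := by
    intro j hj
    rw [Source, show 2 * y % 6 / 2 = y by omega] at hsrc
    rwa [Source, hj]
  have hj1 : (6 * r + 2 * y) % 6 / 2 = y := by omega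
  have hj2 : (6 * r + 2 * y + 1) % 6 / 2 = y := by omega
  have hasc : ∀ i < k, f 0 ∈ floodReach N ω (6 * r + 2 * y) i (f i) := by
    intro i
    induction i with
    | zero =>
      intro _
      exact mem_layeredReach_zero.2 ⟨rfl, by rw [layer_ascending hy, hcol 0 (by omega)],
        hA _ hj1 0, hX _ hj1⟩
    | succ i ih =>
      intro hi
      exact mem_layeredReach_succ.2 ⟨⟨by rw [layer_ascending hy, hcol _ (by omega)], hA _ hj1 _⟩,
        f i, (hf.adj i).symm, ih (by omega)⟩
  have hdesc : ∀ i < k, f 0 ∈ floodReach N ω (6 * r + 2 * y + 1) i (f (2 * k - i)) := by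
    intro i
    induction i with
    | zero =>
      intro _
      have h0 : f (2 * k - 0) = f 0 := by simpa using hf.periodic 0
      rw [h0]
      exact mem_layeredReach_zero.2 ⟨rfl, by
        rw [layer_descending hy, hcol 0 (by omega), Nat.sub_zero, Nat.mod_self],
        hA _ hj2 0, hX _ hj2⟩
    | succ i ih =>
      intro hi
      have hadj := hf.adj (2 * k - (i + 1))
      rw [show 2 * k - (i + 1) + 1 = 2 * k - i by omega] at hadj
      refine mem_layeredReach_succ.2 ⟨⟨?_, hA _ hj2 _⟩, f (2 * k - i), hadj, ih (by omega)⟩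
      rw [layer_descending hy, hcol _ (by omega), Nat.mod_eq_of_lt (by omega)]
      omega
  have hstep := step_lt_steps hk hr hy
  refine ⟨r, hr, hcol k (by omega), y, hy, N.ident (f 0), ?_, ?_⟩
  · rw [Nat.succ_mul] at hstep
    rw [hist_of_lt _ _ _ (by omega), mem_received]
    refine ⟨f (k - 1), ?_, ident_mem_sent (hcard _ hj1) (by omega) (hasc _ (by omega))⟩
    have := hf.adj (k - 1)
    rw [Nat.sub_add_cancel hk] at this
    exact this.symm
  · rw [hist_of_lt _ _ _ hstep, mem_received]
    refine ⟨f (k + 1), hf.adj k, ?_⟩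
    have := hdesc (k - 1) (by omega)
    rw [show 2 * k - (k - 1) = k + 1 by omega] at this
    exact ident_mem_sent (hcard _ hj2) (by omega) this

/-- If the set of selected nodes is small, and either all nodes of some cycle of length `2k` have
small degree, or one of its nodes is selected or has many selected neighbours, then there is a
cycle that is detected as soon as it is coloured consecutively. -/
theorem exists_detectable_cycle (hk : 2 ≤ k) (S : Finset (Fin n)) (hS : S.card ≤ M)
    (hM : ∀ d, d ^ k ≤ n → ∀ i < k, d ^ i ≤ M) (hM1 : 0 < M) {f : ℕ → Fin n}
    (hf : IsCycleSeq N.graph (2 * k) f)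
    (hfS : (∀ m, N.deg (f m) ^ k ≤ n) ∨ ∃ m, f m ∈ S ∨
      k ^ 2 ≤ (Finset.univ.filter fun s => s ∈ S ∧ N.graph.Adj s (f m)).card) :
    ∃ f, IsCycleSeq N.graph (2 * k) f ∧ ∀ ω : Fin n → ColorSeed k K,
      (∀ v, v ∈ S ↔ (ω v).1 = true) → ∀ r < K,
      (∀ m < 2 * k, color (input N ω (f m)) r = m) →
      ∃ v, Rejects (input N ω v) ((protocol n M).hist N ω (steps k K) v) := by
  have hle : ∀ i, M ≤ 2 ^ i * k * M := fun i =>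
    Nat.le_mul_of_pos_left _ (Nat.mul_pos (Nat.two_pow_pos _) (by omega))
  -- The cycle to be detected need not be `f`: any cycle meeting `S` is preferred, so that in the
  -- remaining cases no `2k`-cycle meets `S`, as the density bound requires. The shift by `m` makes
  -- the chosen vertex the source.
  by_cases hB : ∃ g, IsCycleSeq N.graph (2 * k) g ∧ ∃ m, g m ∈ S
  · obtain ⟨g, hg, m, hm⟩ := hB
    refine ⟨_, hg.shift m, fun ω hω r hr hcol => ⟨_, rejects_of_wellColored (hg.shift m) hr
      (y := 1) (by omega) (by omega) hcol ?_ ?_ ?_⟩⟩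
    · exact fun _ => ⟨fun h => by omega, fun h => by omega⟩
    · exact ⟨fun _ => (hω _).1 (by simpa using hm), fun h => by omega⟩
    · intro j hj i _ v
      refine le_trans (Finset.card_le_card ?_) (hS.trans (hle i))
      intro w hw
      exact (hω w).2 ((source_of_mem_layeredReach hw).2.2.1 hj)
  push Not at hB
  rcases hfS with hlight | ⟨m, hm⟩
  · refine ⟨f, hf, fun ω _ r hr hcol => ⟨_, rejects_of_wellColored hf hr
      (y := 0) (by omega) (by omega) hcol ?_ ?_ ?_⟩⟩
    · exact fun m => ⟨fun _ => hlight m, fun h => by omega⟩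
    · exact ⟨fun h => by omega, fun h => by omega⟩
    · intro j hj i hi v
      -- The largest `d` with `d ^ k ≤ n` bounds the degrees of all active nodes simultaneously.
      have hd : Nat.findGreatest (fun d => d ^ k ≤ n) n ^ k ≤ n :=
        Nat.findGreatest_spec (P := fun d => d ^ k ≤ n) (Nat.zero_le n)
          (by simp [show k ≠ 0 by omega])
      refine (card_layeredReach_le_pow (fun u hu => ?_) i v).trans ((hM _ hd i hi).trans (hle i))
      rw [← SimpleGraph.card_neighborFinset_eq_degree, card_neighborFinset]
      have hdeg : N.deg u ^ k ≤ n := hu.1 hj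
      exact Nat.le_findGreatest ((Nat.le_self_pow (by omega) _).trans hdeg) hdeg
  · have hm' := hm.resolve_left (hB f hf m)
    refine ⟨_, hf.shift m, fun ω hω r hr hcol => ⟨_, rejects_of_wellColored (hf.shift m) hr
      (y := 2) (by omega) (by omega) hcol ?_ ?_ ?_⟩⟩
    · refine fun m' => ⟨fun h => by omega, fun _ => ?_⟩
      have := hB f hf (m' + m)
      rw [hω] at this
      simpa [input] using this
    · refine ⟨fun h => by omega, fun _ => ?_⟩
      simpa [hω] using hm'
    · intro j hj i hi v
      have hH : ∀ v, Active n j (input N ω v) → v ∉ S := by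
        intro v hv hvS
        have h1 := hv.2 hj
        rw [hω] at hvS
        exact Bool.false_ne_true (h1.symm.trans hvS)
      rcases i with _ | i
      · have := card_layeredReach_le_pow (G := N.graph)
          (lay := fun v => layer j (input N ω v)) (H := fun v => Active n j (input N ω v))
          (X := fun v => Source j (input N ω v)
            (Finset.univ.filter fun s => (ω s).1 = true ∧ N.graph.Adj s v).card)
          (d := n) (fun v _ => by simpa using (N.graph.degree_lt_card_verts v).le) 0 v
        rw [pow_zero] at this
        exact this.trans (hM1.trans_le (hle 0))
      · refine (card_layeredReach_le hH ?_ hB hi v).trans ?_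
        · intro v hv
          simpa [hω] using hv.2 hj
        · calc S.card * (2 ^ i * (k - 1)) ≤ M * (2 ^ (i + 1) * k) :=
              Nat.mul_le_mul hS (Nat.mul_le_mul (Nat.pow_le_pow_right (by norm_num) (by omega))
                (by omega))
            _ = 2 ^ (i + 1) * k * M := by ring

end EvenCycle

end EvenCycleProtocol

/-! ### Tail bounds for the selection and the density of good colourings -/

section SeedProbability

open scoped Classical
open MeasureTheory

instance (P : NodeProgram) (n : ℕ) : IsProbabilityMeasure (P.seedMeasure n) := by
  unfold NodeProgram.seedMeasure
  infer_instance

theorem NodeProgram.seedMeasure_real_eq_sum (P : NodeProgram) [Fintype P.Seed] (n : ℕ)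
    (A : Set (Fin n → P.Seed)) :
    (P.seedMeasure n).real A = ∑ ω with ω ∈ A, ∏ v, (P.seedDist (ω v)).toReal := by
  have h1 : ∀ ω : Fin n → P.Seed,
      (P.seedMeasure n).real {ω} = ∏ v, (P.seedDist (ω v)).toReal := by
    intro ω
    rw [Measure.real, NodeProgram.seedMeasure, Measure.pi_singleton, ENNReal.toReal_prod]
    refine Finset.prod_congr rfl fun v _ => ?_
    rw [PMF.toMeasure_apply_singleton _ _ (measurableSet_singleton _)]
  simp only [← h1]
  rw [sum_measureReal_singleton]
  congr 1
  ext ω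
  simp

/-- The probability that a Bernoulli variable with parameter `p` takes a given value. -/
def bernoulliWeight (p : ℝ) (b : Bool) : ℝ := if b = true then p else 1 - p

theorem bernoulliWeight_nonneg {p : ℝ} (h0 : 0 ≤ p) (h1 : p ≤ 1) (b : Bool) :
    0 ≤ bernoulliWeight p b := by
  unfold bernoulliWeight
  split_ifs <;> linarith

/-- The law of a seed consisting of a Bernoulli bit and `K` independent uniform colours. -/
noncomputable def colorSeedDist {k : ℕ} (hk : 0 < k) (K : ℕ) {p : ℝ} (h0 : 0 ≤ p) (h1 : p ≤ 1) :
    PMF (ColorSeed k K) :=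
  PMF.ofFintype
    (fun x => ENNReal.ofReal (bernoulliWeight p x.1 * (((2 * k : ℕ) : ℝ) ^ K)⁻¹)) (by
      rw [← ENNReal.ofReal_sum_of_nonneg fun x _ =>
        mul_nonneg (bernoulliWeight_nonneg h0 h1 _) (by positivity), Fintype.sum_prod_type]
      have : (((2 * k : ℕ) : ℝ) ^ K) ≠ 0 := by positivity
      simp only [Finset.sum_const, Finset.card_univ, Fintype.card_fun, Fintype.card_fin,
        Fintype.sum_bool, bernoulliWeight, nsmul_eq_mul, Nat.cast_pow, if_true,
        Bool.false_eq_true, if_false]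
      rw [← ENNReal.ofReal_one]
      congr 1
      push_cast at this ⊢
      field_simp
      ring)

theorem toReal_colorSeedDist {k : ℕ} (hk : 0 < k) (K : ℕ) {p : ℝ} (h0 : 0 ≤ p) (h1 : p ≤ 1)
    (x : ColorSeed k K) :
    (colorSeedDist hk K h0 h1 x).toReal =
      bernoulliWeight p x.1 * (((2 * k : ℕ) : ℝ) ^ K)⁻¹ := by
  rw [colorSeedDist, PMF.ofFintype_apply, ENNReal.toReal_ofReal]
  exact mul_nonneg (bernoulliWeight_nonneg h0 h1 _) (by positivity)

variable {V : Type*} [Fintype V] [DecidableEq V]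

theorem sum_prod_bool (g : V → Bool → ℝ) :
    ∑ b : V → Bool, ∏ v, g v (b v) = ∏ v, (g v true + g v false) := by
  have := Finset.prod_univ_sum (fun _ : V => (Finset.univ : Finset Bool)) g
  rw [Fintype.piFinset_univ] at this
  rw [← this]
  simp

theorem sum_prod_bernoulliWeight (p : ℝ) :
    ∑ b : V → Bool, ∏ v, bernoulliWeight p (b v) = 1 := by
  rw [sum_prod_bool]
  simp [bernoulliWeight]

/-- Upper tail bound for the number of selected vertices. -/
theorem sum_bernoulli_card_gt_le {p : ℝ} (h0 : 0 ≤ p) (h1 : p ≤ 1) {y : ℝ} {M : ℕ}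
    (hy : Fintype.card V * p ≤ y) (hM : 3 * y ≤ M) :
    ∑ b : V → Bool with M < (Finset.univ.filter fun v => b v = true).card,
      ∏ v, bernoulliWeight p (b v) ≤ Real.exp (-y) := by
  calc ∑ b : V → Bool with M < (Finset.univ.filter fun v => b v = true).card,
        ∏ v, bernoulliWeight p (b v)
      ≤ ∑ b : V → Bool with M < (Finset.univ.filter fun v => b v = true).card,
        (∏ v, bernoulliWeight p (b v) * if b v = true then Real.exp 1 else 1) *
          Real.exp (-(3 * y)) := by
        refine Finset.sum_le_sum fun b hb => ?_
        rw [Finset.mem_filter] at hb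
        rw [Finset.prod_mul_distrib, mul_assoc]
        refine le_mul_of_one_le_right
          (Finset.prod_nonneg fun v _ => bernoulliWeight_nonneg h0 h1 _) ?_
        -- Exponential Markov inequality: the weight `exp (X - 3 * y)`, with `X` the number of
        -- selected vertices, is at least `1` on the event. Below, the mean of `exp X` is at most
        -- `exp (2 * p)` to the power `card V`, since `exp 1 < 3`.
        rw [Finset.prod_ite, Finset.prod_const, Finset.prod_const_one, mul_one, ← Real.exp_nat_mul,
          ← Real.exp_add, Real.one_le_exp_iff]
        have : (M : ℝ) ≤ (Finset.univ.filter fun v => b v = true).card := by exact_mod_cast hb.2.le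
        linarith
    _ ≤ ∑ b : V → Bool,
        (∏ v, bernoulliWeight p (b v) * if b v = true then Real.exp 1 else 1) *
          Real.exp (-(3 * y)) := by
        refine Finset.sum_le_sum_of_subset_of_nonneg (Finset.filter_subset _ _) fun b _ _ => ?_
        refine mul_nonneg (Finset.prod_nonneg fun v _ => mul_nonneg
          (bernoulliWeight_nonneg h0 h1 _) ?_) (Real.exp_pos _).le
        split_ifs <;> positivity
    _ = (1 + (Real.exp 1 - 1) * p) ^ Fintype.card V * Real.exp (-(3 * y)) := by
        rw [← Finset.sum_mul,
          sum_prod_bool fun _ b => bernoulliWeight p b * if b = true then Real.exp 1 else 1]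
        simp only [bernoulliWeight, if_true, Bool.false_eq_true, if_false, mul_one,
          Finset.prod_const, Finset.card_univ]
        ring
    _ ≤ Real.exp (2 * p) ^ Fintype.card V * Real.exp (-(3 * y)) := by
        have he := Real.exp_one_lt_three
        have he1 : 1 ≤ Real.exp 1 := Real.one_le_exp zero_le_one
        have h2 := Real.add_one_le_exp (2 * p)
        gcongr
        nlinarith
    _ ≤ Real.exp (-y) := by
        rw [← Real.exp_nat_mul, ← Real.exp_add, Real.exp_le_exp]
        linarith

/-- Lower tail bound for the number of selected vertices in a given set. -/
theorem sum_bernoulli_card_lt_le {p : ℝ} (h0 : 0 ≤ p) (h1 : p ≤ 1) (T : Finset V) (c : ℕ) :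
    ∑ b : V → Bool with (T.filter fun v => b v = true).card < c,
      ∏ v, bernoulliWeight p (b v) ≤ Real.exp (c - T.card * p / 2) := by
  calc ∑ b : V → Bool with (T.filter fun v => b v = true).card < c,
        ∏ v, bernoulliWeight p (b v)
      ≤ ∑ b : V → Bool with (T.filter fun v => b v = true).card < c,
        (∏ v, bernoulliWeight p (b v) * if v ∈ T ∧ b v = true then Real.exp (-1) else 1) *
          Real.exp c := by
        refine Finset.sum_le_sum fun b hb => ?_
        rw [Finset.mem_filter] at hb
        rw [Finset.prod_mul_distrib, mul_assoc]
        refine le_mul_of_one_le_right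
          (Finset.prod_nonneg fun v _ => bernoulliWeight_nonneg h0 h1 _) ?_
        rw [Finset.prod_ite, Finset.prod_const, Finset.prod_const_one, mul_one, ← Real.exp_nat_mul,
          ← Real.exp_add, Real.one_le_exp_iff]
        have h2 : (Finset.univ.filter fun v => v ∈ T ∧ b v = true) =
            T.filter fun v => b v = true := by
          ext v; simp
        have : ((T.filter fun v => b v = true).card : ℝ) ≤ c := by exact_mod_cast hb.2.le
        rw [h2]
        linarith
    _ ≤ ∑ b : V → Bool,
        (∏ v, bernoulliWeight p (b v) * if v ∈ T ∧ b v = true then Real.exp (-1) else 1) *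
          Real.exp c := by
        refine Finset.sum_le_sum_of_subset_of_nonneg (Finset.filter_subset _ _) fun b _ _ => ?_
        refine mul_nonneg (Finset.prod_nonneg fun v _ => mul_nonneg
          (bernoulliWeight_nonneg h0 h1 _) ?_) (Real.exp_pos _).le
        split_ifs <;> positivity
    _ = (∏ v, if v ∈ T then p * Real.exp (-1) + (1 - p) else 1) * Real.exp c := by
        rw [← Finset.sum_mul, sum_prod_bool fun v b =>
          bernoulliWeight p b * if v ∈ T ∧ b = true then Real.exp (-1) else 1]
        congr 1
        refine Finset.prod_congr rfl fun v _ => ?_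
        by_cases hv : v ∈ T <;> simp [bernoulliWeight, hv]
    _ = (p * Real.exp (-1) + (1 - p)) ^ T.card * Real.exp c := by
        simp
    _ ≤ Real.exp (-(p / 2)) ^ T.card * Real.exp c := by
        -- Each factor is then at most `1 - p / 2 ≤ exp (-(p / 2))`.
        have he : Real.exp (-1) ≤ 1 / 2 := by
          rw [Real.exp_neg, inv_eq_one_div]
          exact one_div_le_one_div_of_le two_pos (by linarith [Real.add_one_le_exp 1])
        have he0 := Real.exp_pos (-1)
        have h2 := Real.add_one_le_exp (-(p / 2))
        gcongr
        nlinarith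
    _ = Real.exp (c - T.card * p / 2) := by
        rw [← Real.exp_nat_mul, ← Real.exp_add]
        congr 1
        ring

/-- The fraction of the `K`-tuples of colourings that avoid a set of colourings of density at
least `q`. -/
theorem sum_avoid_le {C : Type*} [Fintype C] [Nonempty C] (Good : Finset (V → C)) {q : ℝ} (K : ℕ)
    (hq : q * (Fintype.card C : ℝ) ^ Fintype.card V ≤ Good.card) :
    ∑ c : Fin K → V → C with ∀ r, c r ∉ Good, ∏ _v : V, ((Fintype.card C : ℝ) ^ K)⁻¹ ≤
      (1 - q) ^ K := by
  have hset : (Finset.univ.filter fun c : Fin K → V → C => ∀ r, c r ∉ Good) =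
      Fintype.piFinset fun _ => Goodᶜ := by
    ext c
    simp [Fintype.mem_piFinset]
  have hC : (0 : ℝ) < Fintype.card C := by exact_mod_cast Fintype.card_pos
  have hpow : (0 : ℝ) < (Fintype.card C : ℝ) ^ Fintype.card V := by positivity
  have hcard : ((Goodᶜ).card : ℝ) = (Fintype.card C : ℝ) ^ Fintype.card V - Good.card := by
    rw [Finset.card_compl, Nat.cast_sub (Finset.card_le_univ _), Fintype.card_fun, Nat.cast_pow]
  rw [Finset.sum_const, hset, Fintype.card_piFinset, Finset.prod_const, Finset.prod_const,
    Finset.card_univ, Finset.card_univ, Fintype.card_fin, nsmul_eq_mul, Nat.cast_pow, inv_pow,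
    ← pow_mul, mul_comm K, pow_mul, ← div_eq_mul_inv, ← div_pow]
  refine pow_le_pow_left₀ (by positivity) ?_ _
  rw [div_le_iff₀ hpow, hcard]
  linarith

/-- If failure requires a bad selection, or that all colourings avoid the good set of the
selection, then its probability is bounded as follows. -/
theorem sum_fail_le {C : Type*} [Fintype C] [Nonempty C] {K : ℕ} {p : ℝ} (h0 : 0 ≤ p) (h1 : p ≤ 1)
    (Fail : (V → Bool × (Fin K → C)) → Prop) (Bad : (V → Bool) → Prop)
    (Good : (V → Bool) → Finset (V → C)) {q : ℝ}
    (hq1 : q ≤ 1)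
    (hq : ∀ b, ¬ Bad b → q * (Fintype.card C : ℝ) ^ Fintype.card V ≤ (Good b).card)
    (hFail : ∀ ω, Fail ω → Bad (fun v => (ω v).1) ∨
      ∀ r, (fun v => (ω v).2 r) ∉ Good fun v => (ω v).1) :
    ∑ ω with Fail ω, ∏ v, (bernoulliWeight p (ω v).1 * ((Fintype.card C : ℝ) ^ K)⁻¹) ≤
      ∑ b with Bad b, ∏ v, bernoulliWeight p (b v) + (1 - q) ^ K := by
  let e : ((V → Bool) × (Fin K → V → C)) ≃ (V → Bool × (Fin K → C)) :=
    { toFun := fun x v => (x.1 v, fun r => x.2 r v)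
      invFun := fun ω => (fun v => (ω v).1, fun r v => (ω v).2 r)
      left_inv := fun _ => rfl
      right_inv := fun _ => rfl }
  set u : ℝ := ((Fintype.card C : ℝ) ^ K)⁻¹ with hu
  have hu0 : 0 ≤ u := by positivity
  have hw : ∀ b : V → Bool, 0 ≤ ∏ v, bernoulliWeight p (b v) := fun b =>
    Finset.prod_nonneg fun v _ => bernoulliWeight_nonneg h0 h1 _
  have hone : ∑ _c : Fin K → V → C, ∏ _v : V, u = 1 := by
    have hC : (Fintype.card C : ℝ) ≠ 0 := by exact_mod_cast Fintype.card_ne_zero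
    rw [Finset.sum_const, Finset.prod_const, Finset.card_univ, Finset.card_univ, Fintype.card_fun,
      Fintype.card_fun, Fintype.card_fin, hu, nsmul_eq_mul, Nat.cast_pow, Nat.cast_pow, inv_pow,
      ← pow_mul, ← pow_mul, mul_comm K]
    exact mul_inv_cancel₀ (pow_ne_zero _ hC)
  rw [Finset.sum_filter, ← e.sum_comp, Fintype.sum_prod_type]
  -- Conditioning on the selection `b` allows the good set of colourings to depend on it; selection
  -- and colours are independent.
  have hb : ∀ b : V → Bool, (∑ c : Fin K → V → C, if Fail (e (b, c)) then
      ∏ v, (bernoulliWeight p (e (b, c) v).1 * u) else 0) ≤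
      (if Bad b then ∏ v, bernoulliWeight p (b v) else 0) +
        (∏ v, bernoulliWeight p (b v)) * (1 - q) ^ K := by
    intro b
    have hterm : ∀ c : Fin K → V → C, ∏ v, (bernoulliWeight p (e (b, c) v).1 * u) =
        (∏ v, bernoulliWeight p (b v)) * ∏ _v : V, u := fun c => Finset.prod_mul_distrib
    simp only [hterm]
    by_cases hbad : Bad b
    · rw [if_pos hbad]
      have h2 : 0 ≤ (∏ v, bernoulliWeight p (b v)) * (1 - q) ^ K :=
        mul_nonneg (hw b) (pow_nonneg (by linarith) _)
      refine le_trans (Finset.sum_le_sum (g := fun _ => (∏ v, bernoulliWeight p (b v)) *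
        ∏ _v : V, u) fun c _ => ?_) ?_
      · split_ifs
        · exact le_rfl
        · exact mul_nonneg (hw b) (Finset.prod_nonneg fun _ _ => hu0)
      · rw [← Finset.mul_sum, hone, mul_one]
        linarith
    · rw [if_neg hbad, zero_add]
      refine le_trans (Finset.sum_le_sum (g := fun c => (∏ v, bernoulliWeight p (b v)) *
        if ∀ r, c r ∉ Good b then ∏ _v : V, u else 0) fun c _ => ?_) ?_
      · by_cases hf : Fail (e (b, c))
        · have hav : ∀ r, c r ∉ Good b := (hFail _ hf).resolve_left hbad
          rw [if_pos hf, if_pos hav]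
        · rw [if_neg hf]
          refine mul_nonneg (hw b) ?_
          split_ifs
          · exact Finset.prod_nonneg fun _ _ => hu0
          · exact le_rfl
      · rw [← Finset.mul_sum, ← Finset.sum_filter]
        exact mul_le_mul_of_nonneg_left (sum_avoid_le (Good b) K (hq b hbad)) (hw b)
  refine (Finset.sum_le_sum fun b _ => hb b).trans ?_
  rw [Finset.sum_add_distrib, ← Finset.sum_mul, sum_prod_bernoulliWeight, one_mul,
    Finset.sum_filter]

/-- The density of the colourings with prescribed colours at `ℓ` vertices. -/
theorem pow_le_card_prescribed_mul {ℓ : ℕ} (g : ℕ → V)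
    (hg : ∀ m < ℓ, ∀ m' < ℓ, g m = g m' → m = m') :
    ℓ ^ Fintype.card V ≤
      (Finset.univ.filter fun c : V → Fin ℓ => ∀ m < ℓ, (c (g m) : ℕ) = m).card * ℓ ^ ℓ := by
  have hset : (Finset.univ.filter fun c : V → Fin ℓ => ∀ m < ℓ, (c (g m) : ℕ) = m) =
      Fintype.piFinset fun v => Finset.univ.filter fun x : Fin ℓ => ∀ m < ℓ, g m = v → (x : ℕ) = m := by
    ext c
    simp only [Finset.mem_filter, Finset.mem_univ, true_and, Fintype.mem_piFinset]
    exact ⟨fun h v m hm hv => hv ▸ h m hm, fun h m hm => h _ m hm rfl⟩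
  rw [hset, Fintype.card_piFinset]
  have h1 : ∏ v : V, (if v ∈ (Finset.range ℓ).image g then ℓ else 1) ≤ ℓ ^ ℓ := by
    rcases Nat.eq_zero_or_pos ℓ with rfl | hℓ
    · simp
    · rw [Finset.prod_ite, Finset.prod_const, Finset.prod_const_one, mul_one]
      refine Nat.pow_le_pow_right hℓ ?_
      rw [Finset.filter_univ_mem]
      exact Finset.card_image_le.trans (by simp)
  refine le_trans ?_ (Nat.mul_le_mul_left _ h1)
  rw [← Finset.prod_mul_distrib, ← Finset.card_univ, ← Finset.prod_const]
  refine Finset.prod_le_prod' fun v _ => ?_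
  split_ifs with hv
  · refine Nat.le_mul_of_pos_left _ (Finset.card_pos.2 ?_)
    obtain ⟨m, hm, rfl⟩ := Finset.mem_image.1 hv
    rw [Finset.mem_range] at hm
    refine ⟨⟨m, hm⟩, ?_⟩
    simp only [Finset.mem_filter, Finset.mem_univ, true_and]
    exact fun m' hm' h => hg _ hm _ hm' h.symm
  · rw [Finset.filter_true_of_mem]
    · simp
    · intro x _ m hm h
      exact absurd (Finset.mem_image.2 ⟨m, Finset.mem_range.2 hm, h⟩) hv

end SeedProbability

/-! ### The compiled program: correctness, error probability, number of rounds -/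

section EvenCycleAlgorithm

open scoped Classical
open MeasureTheory

namespace EvenCycle

open BroadcastProtocol

/-- The program that detects cycles of length `2k` with `K` colourings, selection probability `p`
and threshold parameter `M`. -/
noncomputable def program {k : ℕ} (hk : 0 < k) (a n K M : ℕ) {p : ℝ} (h0 : 0 ≤ p) (h1 : p ≤ 1) :
    NodeProgram :=
  (protocol (k := k) (K := K) n M).compile (colorSeedDist hk K h0 h1) (a * Nat.clog 2 n)
    (stepLength k M) (steps k K) Rejects

/-- The program that accepts at once. -/
noncomputable def acceptingProgram : NodeProgram where
  State := Unit
  Seed := Unit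
  seed_finite := inferInstance
  seedDist := PMF.pure ()
  init _ _ _ := ()
  send _ _ := []
  receive _ _ := ()
  rounds := 0
  output _ := .accept

variable {k a n K M : ℕ} {p : ℝ}

theorem verdict_program_eq_reject_iff (hk : 2 ≤ k) (hn : 2 ≤ n) (hM : 0 < M) (h0 : 0 ≤ p)
    (h1 : p ≤ 1) (N : Network n a) (ω : Fin n → ColorSeed k K) (v : Fin n) :
    (program (by omega : 0 < k) a n K M h0 h1).verdict N ω v = .reject ↔
      Rejects (input N ω v) ((protocol n M).hist N ω (steps k K) v) := by
  -- Two nodes with distinct identifiers force a positive exponent, hence a positive message width.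
  have ha : 1 ≤ a := by
    by_contra ha
    obtain rfl : a = 0 := by omega
    have h2 := N.ident_lt ⟨0, by omega⟩
    have h3 := N.ident_lt ⟨1, by omega⟩
    rw [pow_zero] at h2 h3
    have h4 := @N.ident_injective ⟨0, by omega⟩ ⟨1, by omega⟩ (by omega)
    simp at h4
  have hlog : 1 ≤ Nat.clog 2 n := Nat.clog_pos one_lt_two hn
  refine verdict_compile_eq_reject_iff (Nat.mul_pos ha hlog)
    (one_le_stepLength (by omega) hM) (length_sent_le (by omega) hM) ?_ v
  intro t u x hx
  rcases mem_sent_ident hx with rfl | ⟨w, rfl⟩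
  · exact Nat.two_pow_pos _
  · refine (N.ident_lt w).trans_le ?_
    rw [mul_comm, pow_mul]
    exact Nat.pow_le_pow_left (Nat.le_pow_clog one_lt_two n) a

theorem program_accepts (hk : 2 ≤ k) (hn : 2 ≤ n) (hM : 0 < M) (h0 : 0 ≤ p)
    (h1 : p ≤ 1) (N : Network n a)
    (hN : ¬ (SimpleGraph.cycleGraph (2 * k)).IsContained N.graph)
    (ω : Fin n → ColorSeed k K) (v : Fin n) :
    (program (by omega : 0 < k) a n K M h0 h1).verdict N ω v = .accept := by
  cases h : (program (by omega : 0 < k) a n K M h0 h1).verdict N ω v with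
  | accept => rfl
  | reject =>
    exact absurd (isContained_of_rejects hk
      ((verdict_program_eq_reject_iff hk hn hM h0 h1 N ω v).1 h)) hN

/-- A selection of nodes is unfavourable only with small probability. -/
theorem exists_bad_selection (N : Network n a) (f : ℕ → Fin n) (h0 : 0 ≤ p) (h1 : p ≤ 1)
    {y e : ℝ} (hy : n * p ≤ y) (hyM : 3 * y ≤ M) (hey : e ≤ y)
    (hheavy : ∀ d : ℕ, n < d ^ k → p = 1 ∨ 2 * ((k : ℝ) ^ 2 + e) ≤ d * p) :
    ∃ Bad : (Fin n → Bool) → Prop,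
      ∑ b with Bad b, ∏ v, bernoulliWeight p (b v) ≤ 2 * Real.exp (-e) ∧
      ∀ b, ¬ Bad b → (Finset.univ.filter fun v => b v = true).card ≤ M ∧
        ((∀ m, N.deg (f m) ^ k ≤ n) ∨ ∃ m, b (f m) = true ∨
          k ^ 2 ≤ (Finset.univ.filter fun s => b s = true ∧ N.graph.Adj s (f m)).card) := by
  have hexp : Real.exp (-y) ≤ Real.exp (-e) := by rw [Real.exp_le_exp]; linarith
  have hup := sum_bernoulli_card_gt_le (V := Fin n) h0 h1 (by simpa using hy) hyM
  have hpos := Real.exp_pos (-e)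
  by_cases hlight : ∀ m, N.deg (f m) ^ k ≤ n
  · refine ⟨fun b => M < (Finset.univ.filter fun v => b v = true).card,
      le_trans (le_of_eq (Finset.sum_congr (by ext; simp) fun _ _ => rfl))
        (hup.trans (hexp.trans (by linarith))), ?_⟩
    exact fun b hb => ⟨not_lt.1 hb, Or.inl hlight⟩
  push Not at hlight
  obtain ⟨m, hm⟩ := hlight
  set T := Finset.univ.filter fun s => N.graph.Adj s (f m) with hT
  have hTcard : T.card = N.deg (f m) := by
    rw [← card_neighborFinset]
    congr 1
    ext s
    simp [hT, SimpleGraph.adj_comm]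
  refine ⟨fun b => M < (Finset.univ.filter fun v => b v = true).card ∨
    (b (f m) = false ∧ (T.filter fun v => b v = true).card < k ^ 2), ?_, ?_⟩
  · have hnonneg : ∀ b : Fin n → Bool, 0 ≤ ∏ v, bernoulliWeight p (b v) := fun b =>
      Finset.prod_nonneg fun v _ => bernoulliWeight_nonneg h0 h1 _
    have hlow : ∑ b : Fin n → Bool with
        (b (f m) = false ∧ (T.filter fun v => b v = true).card < k ^ 2),
        ∏ v, bernoulliWeight p (b v) ≤ Real.exp (-e) := by
      -- If `p = 1`, the node `f m` is selected almost surely and the event has weight zero;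
      -- otherwise the lower tail over its neighbourhood applies.
      rcases hheavy _ hm with rfl | hp
      · refine le_trans (le_of_eq (Finset.sum_eq_zero fun b hb => ?_)) hpos.le
        rw [Finset.mem_filter] at hb
        exact Finset.prod_eq_zero (Finset.mem_univ (f m)) (by simp [bernoulliWeight, hb.2.1])
      · refine (Finset.sum_le_sum_of_subset_of_nonneg ?_ fun b _ _ => hnonneg b).trans
          ((sum_bernoulli_card_lt_le h0 h1 T (k ^ 2)).trans ?_)
        · intro b
          simp only [Finset.mem_filter, Finset.mem_univ, true_and]
          exact And.right
        · rw [Real.exp_le_exp, hTcard]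
          push_cast
          linarith
    refine le_trans ?_ ((add_le_add (hup.trans hexp) hlow).trans (two_mul _).ge)
    rw [← Finset.sum_union_inter]
    refine le_trans (le_of_eq ?_) (le_add_of_nonneg_right (Finset.sum_nonneg fun b _ => hnonneg b))
    exact Finset.sum_congr (by ext; simp) fun _ _ => rfl
  · intro b hb
    push Not at hb
    refine ⟨hb.1, Or.inr ⟨m, ?_⟩⟩
    by_cases hbm : b (f m) = true
    · exact Or.inl hbm
    · refine Or.inr ((hb.2 (by simpa using hbm)).trans (le_of_eq ?_))
      congr 1
      ext s
      simp [hT, and_comm]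

noncomputable instance (hk : 0 < k) (h0 : 0 ≤ p) (h1 : p ≤ 1) :
    Fintype (program hk a n K M h0 h1).Seed :=
  inferInstanceAs (Fintype (ColorSeed k K))

theorem seedMeasure_program_real (hk : 0 < k) (h0 : 0 ≤ p) (h1 : p ≤ 1)
    (A : Set (Fin n → ColorSeed k K)) :
    ((program hk a n K M h0 h1).seedMeasure n).real A =
      ∑ ω with ω ∈ A, ∏ v, (bernoulliWeight p (ω v).1 * (((2 * k : ℕ) : ℝ) ^ K)⁻¹) := by
  refine (NodeProgram.seedMeasure_real_eq_sum (program hk a n K M h0 h1) n A).trans ?_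
  exact Finset.sum_congr rfl fun ω _ => Finset.prod_congr rfl fun v _ =>
    toReal_colorSeedDist hk K h0 h1 (ω v)

/-- Three events of probability at most `exp (-e)` each can cause failure: too many selected nodes,
a heavy cycle vertex neither selected nor with enough selected neighbours, and no consecutive
colouring of the detectable cycle. -/
theorem program_rejects (hk : 2 ≤ k) (hn : 2 ≤ n) (hM0 : 0 < M) (h0 : 0 ≤ p) (h1 : p ≤ 1)
    (hM : ∀ d, d ^ k ≤ n → ∀ i < k, d ^ i ≤ M)
    {y e : ℝ} (hy : n * p ≤ y) (hyM : 3 * y ≤ M) (hey : e ≤ y)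
    (hheavy : ∀ d : ℕ, n < d ^ k → p = 1 ∨ 2 * ((k : ℝ) ^ 2 + e) ≤ d * p)
    (hK : e * ((2 * k : ℕ) : ℝ) ^ (2 * k) ≤ K) (N : Network n a)
    (hN : (SimpleGraph.cycleGraph (2 * k)).IsContained N.graph) :
    1 - 3 * Real.exp (-e) ≤ ((program (by omega : 0 < k) a n K M h0 h1).seedMeasure n).real
      {ω | ∃ v, (program (by omega : 0 < k) a n K M h0 h1).verdict N ω v = .reject} := by
  obtain ⟨f, hf⟩ := IsCycleSeq.exists_of_isContained (by omega) hN
  obtain ⟨Bad, hBad, hgood⟩ := exists_bad_selection N f h0 h1 hy hyM hey hheavy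
  -- The detectable cycle depends on the selection alone, so it is fixed before the colours are
  -- drawn. For a bad selection `f` is an arbitrary value.
  have hdet : ∀ b : Fin n → Bool, ∃ g : ℕ → Fin n, ¬ Bad b → IsCycleSeq N.graph (2 * k) g ∧
      ∀ ω : Fin n → ColorSeed k K, (∀ v, (ω v).1 = b v) → ∀ r < K,
      (∀ m < 2 * k, color (input N ω (g m)) r = m) →
      ∃ v, Rejects (input N ω v) ((protocol n M).hist N ω (steps k K) v) := by
    intro b
    by_cases hb : Bad b
    · exact ⟨f, fun h => absurd hb h⟩
    · obtain ⟨hS, hfS⟩ := hgood b hb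
      obtain ⟨g, hg, hgd⟩ := exists_detectable_cycle hk
        (Finset.univ.filter fun v => b v = true) hS hM hM0 hf (by simpa using hfS)
      exact ⟨g, fun _ => ⟨hg, fun ω hω => hgd ω (by simp [hω])⟩⟩
  choose g hg using hdet
  set c : ℝ := ((2 * k : ℕ) : ℝ) with hc
  have hc0 : (0 : ℝ) < c ^ (2 * k) := by
    have : 0 < 2 * k := by omega
    have : 0 < c := by rw [hc]; exact_mod_cast this
    positivity
  have hc1 : (1 : ℝ) ≤ c ^ (2 * k) := by
    refine one_le_pow₀ ?_
    rw [hc]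
    exact_mod_cast (by omega : 1 ≤ 2 * k)
  have : Nonempty (Fin (2 * k)) := ⟨⟨0, by omega⟩⟩
  set A : Set (Fin n → ColorSeed k K) :=
    {ω | ∃ v, Rejects (input N ω v) ((protocol n M).hist N ω (steps k K) v)} with hA
  have hset : {ω | ∃ v, (program (by omega : 0 < k) a n K M h0 h1).verdict N ω v = .reject} = A :=
    Set.ext fun ω => exists_congr fun v => verdict_program_eq_reject_iff hk hn hM0 h0 h1 N ω v
  suffices h : 1 - 3 * Real.exp (-e) ≤
      ((program (by omega : 0 < k) a n K M h0 h1).seedMeasure n).real A from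
    h.trans_eq (congrArg _ hset.symm)
  have hmeas : @MeasurableSet (Fin n → (program (by omega : 0 < k) a n K M h0 h1).Seed) _ A :=
    Set.Finite.measurableSet (Set.toFinite _)
  have hfail : ((program (by omega : 0 < k) a n K M h0 h1).seedMeasure n).real Aᶜ ≤
      3 * Real.exp (-e) := by
    refine (seedMeasure_program_real (by omega) h0 h1 Aᶜ).trans_le ?_
    have hdensity : ∀ b, ¬ Bad b →
        (c ^ (2 * k))⁻¹ * (Fintype.card (Fin (2 * k)) : ℝ) ^ Fintype.card (Fin n) ≤
        (Finset.univ.filter fun c : Fin n → Fin (2 * k) =>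
          ∀ m < 2 * k, (c (g b m) : ℕ) = m).card := by
      intro b hb
      have h2 := pow_le_card_prescribed_mul (g b) (hg b hb).1.inj
      rw [inv_mul_le_iff₀ hc0, mul_comm (c ^ _), hc]
      simp only [Fintype.card_fin] at h2 ⊢
      exact_mod_cast h2
    have hcover : ∀ ω : Fin n → ColorSeed k K, ω ∈ Aᶜ → Bad (fun v => (ω v).1) ∨
        ∀ r, (fun v => (ω v).2 r) ∉ Finset.univ.filter fun c : Fin n → Fin (2 * k) =>
          ∀ m < 2 * k, (c (g (fun v => (ω v).1) m) : ℕ) = m := by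
      intro ω hω
      by_cases hb : Bad fun v => (ω v).1
      · exact Or.inl hb
      · refine Or.inr fun r hr => hω ?_
        refine (hg _ hb).2 ω (fun _ => rfl) r r.2 fun m hm => ?_
        rw [Finset.mem_filter] at hr
        rw [color, dif_pos r.2]
        exact hr.2 m hm
    have hexp : (1 - (c ^ (2 * k))⁻¹) ^ K ≤ Real.exp (-e) := by
      have h2 := Real.add_one_le_exp (-(c ^ (2 * k))⁻¹)
      calc (1 - (c ^ (2 * k))⁻¹) ^ K ≤ Real.exp (-(c ^ (2 * k))⁻¹) ^ K := by
            refine pow_le_pow_left₀ ?_ (by linarith) _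
            have := inv_le_one_of_one_le₀ hc1
            linarith
        _ = Real.exp (-(K / c ^ (2 * k))) := by
            rw [← Real.exp_nat_mul]
            congr 1
            ring
        _ ≤ Real.exp (-e) := by
            rw [Real.exp_le_exp, neg_le_neg_iff, le_div_iff₀ hc0]
            exact hK
    have hsum := sum_fail_le h0 h1 (fun ω => ω ∈ Aᶜ) Bad _ (inv_le_one_of_one_le₀ hc1) hdensity
      hcover
    rw [Fintype.card_fin] at hsum
    exact hsum.trans ((add_le_add hBad hexp).trans (by linarith))
  have hcompl := (probReal_compl_eq_one_sub hmeas).symm.trans_le hfail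
  linarith

/-- The thresholds within one flood form a geometric series with sum below `2 ^ k * k * M`. There
are `6 * K` floods, and the announcement round is absorbed by raising `6` to `7`. -/
theorem sum_stepLength_le (hk : 0 < k) (hM : 0 < M) (hK : 0 < K) :
    ∑ t ∈ Finset.range (steps k K), stepLength k M t ≤ 7 * (K * (2 ^ k * k * M)) := by
  have hblock : ∀ j, ∑ t ∈ Finset.range (j * k), 2 ^ (t % k) * k * M ≤ j * (2 ^ k * k * M) := by
    intro j
    induction j with
    | zero => simp
    | succ j ih =>
      rw [Nat.succ_mul, Finset.sum_range_add, Nat.succ_mul]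
      refine Nat.add_le_add ih ?_
      have : ∀ t ∈ Finset.range k, 2 ^ ((j * k + t) % k) * k * M = 2 ^ t * (k * M) := by
        intro t ht
        rw [Nat.mul_add_mod_self_right, Nat.mod_eq_of_lt (Finset.mem_range.1 ht), mul_assoc]
      rw [Finset.sum_congr rfl this, ← Finset.sum_mul, mul_assoc]
      refine Nat.mul_le_mul_right _ ?_
      have := Nat.geomSum_lt (m := 2) (n := k) (s := Finset.range k) le_rfl (by simp)
      exact this.le
  have h1 : 1 ≤ K * (2 ^ k * k * M) :=
    Nat.mul_pos hK (Nat.mul_pos (Nat.mul_pos (Nat.two_pow_pos _) hk) hM)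
  have h2 := hblock (6 * K)
  rw [steps, Finset.sum_range_add]
  have h3 : ∀ t ∈ Finset.range (6 * K * k), stepLength k M (1 + t) = 2 ^ (t % k) * k * M := by
    intro t _
    rw [stepLength, if_neg (by omega), Nat.add_sub_cancel_left]
  rw [Finset.sum_congr rfl h3]
  have h4 : ∑ t ∈ Finset.range 1, stepLength k M t = 1 := by simp [stepLength]
  rw [h4]
  have h5 : 6 * K * (2 ^ k * k * M) = 6 * (K * (2 ^ k * k * M)) := mul_assoc _ _ _
  omega

end EvenCycle

end EvenCycleAlgorithm

/-! ### Choice of the parameters -/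

section EvenCycleTheorem

open MeasureTheory

namespace EvenCycle

/-- With `m` the maximum, `exp (-2m) ≤ 1/3` because `m ≥ 1`, and `exp (-m) ≤ ε` because `m ≥ log
(1/ε)`. -/
theorem three_mul_exp_neg_le {ε : ℝ} (hε : 0 < ε) :
    3 * Real.exp (-(3 * max 1 (Real.log (1 / ε)))) ≤ ε := by
  set m := max 1 (Real.log (1 / ε)) with hm
  have h1 : 1 ≤ m := le_max_left _ _
  have h2 : Real.exp (-m) ≤ ε := by
    rw [← Real.le_log_iff_exp_le hε, neg_le, ← Real.log_inv, ← one_div]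
    exact le_max_right _ _
  have h3 : Real.exp (-(2 * m)) ≤ 1 / 3 := by
    rw [Real.exp_neg, inv_eq_one_div]
    exact one_div_le_one_div_of_le (by norm_num) (by linarith [Real.add_one_le_exp (2 * m)])
  calc 3 * Real.exp (-(3 * m)) = 3 * (Real.exp (-(2 * m)) * Real.exp (-m)) := by
        rw [← Real.exp_add]
        congr 2
        ring
    _ ≤ 3 * (1 / 3 * ε) := by gcongr
    _ = ε := by ring

theorem pow_le_rpow_of_pow_le {k n d i : ℕ} (hk : 0 < k) (hn : 0 < n) (hd : d ^ k ≤ n)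
    (hi : i < k) : (d : ℝ) ^ i ≤ (n : ℝ) ^ (1 - 1 / (k : ℝ)) := by
  have hk' : (0 : ℝ) < k := by exact_mod_cast hk
  have hk1 : (1 : ℝ) ≤ k := by exact_mod_cast hk
  have hexp : 0 ≤ 1 - 1 / (k : ℝ) := by
    rw [sub_nonneg, div_le_one hk']
    exact hk1
  have hone : (1 : ℝ) ≤ (n : ℝ) ^ (1 - 1 / (k : ℝ)) :=
    Real.one_le_rpow (by exact_mod_cast hn) hexp
  rcases Nat.eq_zero_or_pos d with rfl | hd0
  · refine le_trans ?_ hone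
    exact pow_le_one₀ (by simp) (by simp)
  · calc (d : ℝ) ^ i ≤ (d : ℝ) ^ (k - 1) :=
          pow_le_pow_right₀ (by exact_mod_cast hd0) (by omega)
      _ = ((d : ℝ) ^ k) ^ (1 - 1 / (k : ℝ)) := by
          rw [← Real.rpow_natCast, ← Real.rpow_natCast, ← Real.rpow_mul (by positivity),
            Nat.cast_sub hk]
          congr 1
          field_simp
          simp
      _ ≤ (n : ℝ) ^ (1 - 1 / (k : ℝ)) :=
          Real.rpow_le_rpow (by positivity) (by exact_mod_cast hd) hexp

theorem rpow_le_of_lt_pow {k n d : ℕ} (hk : 0 < k) (hd : n < d ^ k) :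
    (n : ℝ) ^ (1 / (k : ℝ)) ≤ d := by
  have hk' : (k : ℝ) ≠ 0 := by exact_mod_cast hk.ne'
  calc (n : ℝ) ^ (1 / (k : ℝ)) ≤ ((d : ℝ) ^ k) ^ (1 / (k : ℝ)) :=
        Real.rpow_le_rpow (by positivity) (by exact_mod_cast hd.le) (by positivity)
    _ = d := by
        rw [← Real.rpow_natCast, ← Real.rpow_mul (by positivity), mul_one_div_cancel hk',
          Real.rpow_one]

theorem exists_nodeProgram (a : ℕ) {k : ℕ} (hk : 2 ≤ k) {ε : ℝ} (hε : 0 < ε) (n : ℕ) :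
    ∃ P : NodeProgram, P.BandwidthAtMost (a * Nat.clog 2 n) ∧
      (∀ N : Network n a,
        ((SimpleGraph.cycleGraph (2 * k)).IsContained N.graph →
          1 - ε ≤ (P.seedMeasure n).real {ω | ∃ v, P.verdict N ω v = Verdict.reject}) ∧
        (¬ (SimpleGraph.cycleGraph (2 * k)).IsContained N.graph →
          (P.seedMeasure n).real {ω | ∀ v, P.verdict N ω v = Verdict.accept} = 1)) ∧
      (P.rounds : ℝ) ≤ 3024 * (max 1 (Real.log (1 / ε)) ^ 2 * 2 ^ (3 * k) *
        (k : ℝ) ^ (2 * k + 3) * (n : ℝ) ^ (1 - 1 / (k : ℝ))) := by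
  -- Below `2 * k` nodes there is no such cycle, and accepting at once is correct; this also
  -- disposes of the degenerate sizes `n = 0, 1`.
  rcases lt_or_ge n (2 * k) with hn | hn
  · refine ⟨acceptingProgram, fun _ _ => Nat.zero_le _, fun N => ⟨fun h => ?_, fun _ => ?_⟩, ?_⟩
    · obtain ⟨f⟩ := h
      have := Fintype.card_le_of_injective _ f.injective
      simp only [Fintype.card_fin] at this
      omega
    · rw [show {ω : Fin n → acceptingProgram.Seed |
        ∀ v, acceptingProgram.verdict N ω v = Verdict.accept} = Set.univ from
        Set.eq_univ_of_forall fun _ _ => rfl]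
      simp
    · simp only [acceptingProgram, Nat.cast_zero]
      positivity
  have hk0 : 0 < k := by omega
  have hn0 : 0 < n := by omega
  have hkR : (0 : ℝ) < k := by exact_mod_cast hk0
  have hk1 : (1 : ℝ) ≤ k := by exact_mod_cast hk0
  have hnR : (0 : ℝ) < n := by exact_mod_cast hn0
  set m := max 1 (Real.log (1 / ε)) with hm
  have hm1 : 1 ≤ m := le_max_left _ _
  set x : ℝ := (n : ℝ) ^ (1 - 1 / (k : ℝ)) with hx
  have hx1 : 1 ≤ x := by
    have := pow_le_rpow_of_pow_le (d := 0) (i := 0) hk0 hn0 (by simp [hk0.ne']) hk0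
    rwa [pow_zero] at this
  set z : ℝ := (n : ℝ) ^ (1 / (k : ℝ)) with hz
  have hz0 : 0 < z := Real.rpow_pos_of_pos hnR _
  have hxz : x * z = n := by
    rw [hx, hz, ← Real.rpow_add hnR]
    simp
  -- The error exponent is `e = 3 * m`. The constant `c` is at least `2 * (k ^ 2 + e)`, as the lower
  -- tail at a heavy vertex needs; with `p ≤ c / z` the expected number of selected nodes is at most
  -- `c * x`.
  set c : ℝ := 4 * (k : ℝ) ^ 2 * (3 * m) with hc
  have hkk : (1 : ℝ) ≤ (k : ℝ) ^ 2 := one_le_pow₀ hk1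
  have hc0 : 3 * m ≤ c := by rw [hc]; nlinarith
  have hc2 : 2 * ((k : ℝ) ^ 2 + 3 * m) ≤ c := by rw [hc]; nlinarith
  have hcx : 3 * m ≤ c * x := by nlinarith
  set p : ℝ := min 1 (c / z) with hp
  have hp0 : 0 ≤ p := le_min zero_le_one (div_nonneg (by linarith) hz0.le)
  have hp1 : p ≤ 1 := min_le_left _ _
  set M : ℕ := ⌈3 * (c * x)⌉₊ with hM
  have hMle : 3 * (c * x) ≤ M := Nat.le_ceil _
  have hMge : (M : ℝ) ≤ 6 * (c * x) := by
    have := (Nat.ceil_lt_add_one (a := 3 * (c * x)) (by linarith)).le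
    linarith
  have hM0 : 0 < M := by
    have : (0 : ℝ) < M := by linarith
    exact_mod_cast this
  set D : ℝ := ((2 * k : ℕ) : ℝ) ^ (2 * k) with hD
  have hD1 : 1 ≤ D := one_le_pow₀ (by exact_mod_cast (by omega : 1 ≤ 2 * k))
  have hDm : 3 ≤ 3 * m * D := by nlinarith
  set K : ℕ := ⌈3 * m * D⌉₊ with hK
  have hKle : 3 * m * D ≤ K := Nat.le_ceil _
  have hKge : (K : ℝ) ≤ 6 * m * D := by
    have := (Nat.ceil_lt_add_one (a := 3 * m * D) (by linarith)).le
    linarith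
  have hK0 : 0 < K := by
    have : (0 : ℝ) < K := by linarith
    exact_mod_cast this
  refine ⟨program hk0 a n K M hp0 hp1, BroadcastProtocol.compile_bandwidthAtMost,
    fun N => ⟨fun h => ?_, fun h => ?_⟩, ?_⟩
  · have hmain := program_rejects (K := K) hk (by omega) hM0 hp0 hp1 ?_ (y := c * x) (e := 3 * m)
      ?_ hMle hcx ?_ hKle N h
    · refine le_trans ?_ hmain
      linarith [three_mul_exp_neg_le hε]
    · intro d hd i hi
      have h1 := pow_le_rpow_of_pow_le hk0 hn0 hd hi
      have h2 : (d : ℝ) ^ i ≤ M := by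
        refine h1.trans (le_trans ?_ hMle)
        nlinarith
      exact_mod_cast h2
    · calc (n : ℝ) * p ≤ n * (c / z) := by
            gcongr
            exact min_le_right _ _
        _ = c * x := by
            rw [← hxz]
            field_simp
    · intro d hd
      rcases le_total 1 (c / z) with h1 | h1
      · exact Or.inl (min_eq_left h1)
      · right
        rw [hp, min_eq_right h1]
        refine hc2.trans ?_
        rw [mul_div_assoc', le_div_iff₀ hz0, mul_comm]
        exact mul_le_mul_of_nonneg_right (rpow_le_of_lt_pow hk0 hd) (by linarith)
  · rw [show {ω | ∀ v, (program hk0 a n K M hp0 hp1).verdict N ω v = Verdict.accept} = Set.univ from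
      Set.eq_univ_of_forall fun ω v => program_accepts hk (by omega) hM0 hp0 hp1 N h ω v]
    simp
  · have hrounds : (program hk0 a n K M hp0 hp1).rounds ≤ 7 * (K * (2 ^ k * k * M)) :=
      sum_stepLength_le hk0 hM0 hK0
    calc ((program hk0 a n K M hp0 hp1).rounds : ℝ) ≤ 7 * (K * (2 ^ k * k * M)) := by
          exact_mod_cast hrounds
      _ ≤ 7 * ((6 * m * D) * (2 ^ k * k * (6 * (c * x)))) := by gcongr
      -- `3024 = 7 * 6 * 6 * 12`: the rounds, the two ceilings, and the factor `12` in `c`. The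
      -- powers come from `(2 * k) ^ (2 * k)`, `2 ^ k * k` and `k ^ 2`.
      _ = 3024 * (m ^ 2 * 2 ^ (3 * k) * (k : ℝ) ^ (2 * k + 3) * x) := by
          rw [hD, hc]
          push_cast
          rw [mul_pow, show 3 * k = 2 * k + k by ring, pow_add 2, pow_add (k : ℝ)]
          ring

end EvenCycle

end EvenCycleTheorem

theorem theorem1 :
    ∃ C : ℝ, ∀ a : ℕ, ∃ b : ℕ, ∀ k : ℕ, 2 ≤ k → ∀ ε : ℝ, 0 < ε →
      ∃ A : DistributedAlgorithm,
        A.IsCongest b ∧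
        A.SolvesCycleFreeness a (2 * k) ε ∧
        ∀ n : ℕ, ((A n).rounds : ℝ) ≤
          C * (max 1 (Real.log (1 / ε)) ^ 2 * 2 ^ (3 * k) * (k : ℝ) ^ (2 * k + 3) *
            (n : ℝ) ^ (1 - 1 / (k : ℝ))) := by
  refine ⟨3024, fun a => ⟨a, fun k hk ε hε => ?_⟩⟩
  choose A hA using fun n => EvenCycle.exists_nodeProgram a hk hε n
  exact ⟨A, fun n => (hA n).1, fun n N => (hA n).2.1 N, fun n => (hA n).2.2⟩
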